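/- Let $M\ge 2$ and $B\ge 0$ be integers and let $P>0$. A transmitter with $M$ antennas serves $M$ single-antenna mobiles with channel vectors $\mathbf h_1,\dots,\mathbf h_M\in\mathbb C^M$, all of whose entries are iid circularly symmetric complex Gaussians of unit variance (Rayleigh fading). Mobile $i$ has a random codebook $\mathbf w_{i,1},\dots,\mathbf w_{i,2^B}$; all codewords of all mobiles are independent of each other and of the channels, and isotropically distributed on the unit sphere of $\mathbb C^M$ (random vector quantization). Mobile $i$ feeds back, with $B$ bits, an index $F_i$ maximizing $|\mathbf h_i^\dagger\mathbf w_{i,j}|$ over $j$ (ties broken arbitrarily); put $\hat{\mathbf h}_i=\mathbf w_{i,F_i}$. Let $\mathbf H$ and $\hat{\mathbf H}$ be the $M\times M$ matrices with rows $\mathbf h_i^\dagger$ and $\hat{\mathbf h}_i^\dagger$, let $\mathbf v_{ZF,i}$ be the normalized $i$-th column of $\mathbf H^{-1}$ (zero-forcing with perfect channel knowledge at the transmitter) and $\mathbf v_i$ the normalized $i$-th column of $\hat{\mathbf H}^{-1}$ (zero-forcing on the quantized channels). With power $P/M$ per mobile, the average rates of mobile $i$ are $$R_{ZF,i}(P)=E\Big[\log_2\Big(1+\tfrac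 PM|\mathbf h_i^\dagger\mathbf v_{ZF,i}|^2\Big)\Big],\qquad R_{FB,i}(P)=E\big[\log_2(1+\mathrm{SINR}_i)\big],\qquad \mathrm{SINR}_i=\frac{\frac PM|\mathbf h_i^\dagger\mathbf v_i|^2}{1+\sum_{j\ne i}\frac PM|\mathbf h_i^\dagger\mathbf v_j|^2},$$ with expectations over the channels and the codebooks. Let $R_{ZF}(P)=\sum_i R_{ZF,i}(P)$, $R_{FB}(P)=\sum_i R_{FB,i}(P)$ and $\Delta R(P)=\frac1M\,[R_{ZF}(P)-R_{FB}(P)]$. Then $\mathbf H$ and $\hat{\mathbf H}$ are almost surely invertible, the rates inside the expectations are integrable, and $$R_{ZF,i}(P)-R_{FB,i}(P)<\log_2\big(1+P\cdot 2^{-B/(M-1)}\big)\quad\text{for every } i,\qquad\text{and}\qquad \Delta R(P)<\log_2\big(1+P\cdot 2^{-B/(M-1)}\big).$$ -/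

import Mathlib

open MeasureTheory ProbabilityTheory

noncomputable section

namespace FiniteRateFeedback

/-- The space `ℂ^M` of column vectors, with its Euclidean norm. The scalar `x† y` is
`inner ℂ x y`, which is conjugate-linear in its first argument. -/
abbrev CVec (M : ℕ) : Type := EuclideanSpace ℂ (Fin M)

/-- The circularly symmetric complex Gaussian law of unit variance: the real and the imaginary
part are independent real Gaussians with mean `0` and variance `1 / 2`. -/
def complexGaussian : Measure ℂ :=
  ((gaussianReal 0 (1 / 2)).prod (gaussianReal 0 (1 / 2))).map
    (fun p : ℝ × ℝ => (⟨p.1, p.2⟩ : ℂ))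

/-- The isotropic distribution on the unit sphere of `ℂ^M`: a probability measure carried by the
unit sphere and invariant under every unitary map. -/
structure IsIsotropic {M : ℕ} (ν : Measure (CVec M)) : Prop where
  isProbabilityMeasure : IsProbabilityMeasure ν
  ae_norm_eq_one : ∀ᵐ x ∂ν, ‖x‖ = 1
  map_unitary : ∀ U : CVec M ≃ₗᵢ[ℂ] CVec M, ν.map U = ν

variable {Ω : Type*} [MeasurableSpace Ω]

/-- iid Rayleigh fading: `h i` is the channel vector of mobile `i`, and the `M * M` entries of
the channel vectors are iid unit variance complex Gaussians. -/
structure IsRayleighFading {M : ℕ} (μ : Measure Ω) (h : Fin M → Ω → CVec M) : Prop where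
  measurable : ∀ i, Measurable (h i)
  entry_law : ∀ i k, μ.map (fun ω => h i ω k) = complexGaussian
  entry_indep : iIndepFun (fun (p : Fin M × Fin M) (ω : Ω) => h p.1 ω p.2) μ

/-- Random vector quantization: mobile `i` has the codebook `W i 0, …, W i (2 ^ B - 1)`, and all
the codewords of all the mobiles are independent and isotropic on the unit sphere. -/
structure IsRVQ {M B : ℕ} (μ : Measure Ω) (W : Fin M → Fin (2 ^ B) → Ω → CVec M) : Prop where
  measurable : ∀ i j, Measurable (W i j)
  codeword_law : ∀ i j, IsIsotropic (μ.map (W i j))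
  codeword_indep : iIndepFun (fun (p : Fin M × Fin (2 ^ B)) (ω : Ω) => W p.1 p.2 ω) μ

/-- The collection of the channels and the collection of the codebooks are independent. -/
def ChannelsIndepCodebooks {M B : ℕ} (μ : Measure Ω) (h : Fin M → Ω → CVec M)
    (W : Fin M → Fin (2 ^ B) → Ω → CVec M) : Prop :=
  IndepFun (fun (ω : Ω) (i : Fin M) => h i ω) (fun (ω : Ω) (i : Fin M) (j : Fin (2 ^ B)) => W i j ω) μ

/-- `F i` is the index fed back by mobile `i`: it maximizes `|h_i† w_j|` over the codebook of
mobile `i`. Ties may be broken in any way. -/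
def IsFeedback {M B : ℕ} (h : Fin M → Ω → CVec M) (W : Fin M → Fin (2 ^ B) → Ω → CVec M)
    (F : Fin M → Ω → Fin (2 ^ B)) : Prop :=
  ∀ i ω j, ‖inner ℂ (h i ω) (W i j ω)‖ ≤ ‖inner ℂ (h i ω) (W i (F i ω) ω)‖

/-- The quantized channel `ĥ i` of mobile `i`. -/
def quantized {M B : ℕ} (W : Fin M → Fin (2 ^ B) → Ω → CVec M) (F : Fin M → Ω → Fin (2 ^ B))
    (i : Fin M) (ω : Ω) : CVec M :=
  W i (F i ω) ω

/-- The concatenation of the vectors `g 0, …, g (M - 1)`: the matrix whose `i`-th row is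
`(g i)†`. -/
def concat {M : ℕ} (g : Fin M → CVec M) : Matrix (Fin M) (Fin M) ℂ :=
  Matrix.of fun i k => star (g i k)

/-- The zero-forcing beamforming vectors computed from `g 0, …, g (M - 1)`: the normalized columns
of the inverse of `concat g` (where this matrix is singular, the value is `0`). -/
def zfBeam {M : ℕ} (g : Fin M → CVec M) (i : Fin M) : CVec M :=
  let c : CVec M := WithLp.toLp 2 ((concat g)⁻¹.col i)
  ((‖c‖⁻¹ : ℝ) : ℂ) • c

/-- The SINR at mobile `i` when the channels are `h`, the beamforming vectors are `v`, and each of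
the `M` symbols has power `P / M`. -/
def sinr {M : ℕ} (P : ℝ) (h v : Fin M → CVec M) (i : Fin M) : ℝ :=
  (P / M * ‖inner ℂ (h i) (v i)‖ ^ 2) /
    (1 + ∑ j ∈ Finset.univ.erase i, P / M * ‖inner ℂ (h i) (v j)‖ ^ 2)

/-- The instantaneous rate of mobile `i` under zero-forcing with perfect CSIT. -/
def instRateZF {M : ℕ} (P : ℝ) (h : Fin M → Ω → CVec M) (i : Fin M) (ω : Ω) : ℝ :=
  Real.logb 2 (1 + P / M * ‖inner ℂ (h i ω) (zfBeam (fun j => h j ω) i)‖ ^ 2)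

/-- The instantaneous rate of mobile `i` under zero-forcing on the quantized channels. -/
def instRateFB {M B : ℕ} (P : ℝ) (h : Fin M → Ω → CVec M) (W : Fin M → Fin (2 ^ B) → Ω → CVec M)
    (F : Fin M → Ω → Fin (2 ^ B)) (i : Fin M) (ω : Ω) : ℝ :=
  Real.logb 2 (1 + sinr P (fun j => h j ω) (zfBeam fun j => quantized W F j ω) i)

/-- The system throughput under zero-forcing with perfect CSIT. -/
def throughputZF {M : ℕ} (μ : Measure Ω) (P : ℝ) (h : Fin M → Ω → CVec M) : ℝ :=
  ∑ i, ∫ ω, instRateZF P h i ω ∂μ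

/-- The system throughput under zero-forcing on the quantized channels, averaged over the fading
and over the random codebooks. -/
def throughputFB {M B : ℕ} (μ : Measure Ω) (P : ℝ) (h : Fin M → Ω → CVec M)
    (W : Fin M → Fin (2 ^ B) → Ω → CVec M) (F : Fin M → Ω → Fin (2 ^ B)) : ℝ :=
  ∑ i, ∫ ω, instRateFB P h W F i ω ∂μ

/-- The rate gap `ΔR(P)`. -/
def rateGap {M B : ℕ} (μ : Measure Ω) (P : ℝ) (h : Fin M → Ω → CVec M)
    (W : Fin M → Fin (2 ^ B) → Ω → CVec M) (F : Fin M → Ω → Fin (2 ^ B)) : ℝ :=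
  1 / M * (throughputZF μ P h - throughputFB μ P h W F)

end FiniteRateFeedback

end

/-! The direction of a zero-forcing beam for mobile `i` depends only on the vectors of the other
mobiles, and is therefore independent of `h i`. By unitary invariance of the Rayleigh law, the
useful amplitude has the modulus law of one complex Gaussian, with true as well as with quantized
channels (`map_norm_inner_zfBeam`). With `s` the signal and `S` the interference power, `log (1 + s
/ (1 + S)) ≥ log (1 + s) - log (1 + S)`; the `s` terms cancel in the mean, and the loss is at most
`E log (1 + S) ≤ log (1 + E S)`.

The bound on `E S` rests on two isotropy arguments. Given the channel `h` and the quantized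
direction `w` of mobile `i`, an interfering beam is orthogonal to `w`, so it sees only the part of
`h` orthogonal to `w`. The other quantized directions are independent and isotropic, hence invariant
under the unitaries fixing `w`, and each interferer collects in mean at most `1 / (M - 1)` of that
energy (`integral_norm_inner_zfBeam_update_le`). The `M - 1` interferers cancel this factor, and `E
‖h‖ ^ 2 = M` cancels the `M` of `P / M`.

What remains is the mean squared sine of the quantization angle. For one codeword its `(M - 1)`-th
power is uniform on `[0, 1]` (`IsIsotropic.map_quantization_error_pow`); the minimum of `N = 2 ^ B`
independent uniforms has mean `1 / (N + 1)`, and Jensen for `x ^ (M - 1)` bounds the mean sine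
squared by `(1 / (N + 1)) ^ (1 / (M - 1))`. Since `N + 1 > 2 ^ B`, the final bound is strict.

The feedback index need not be measurable. Ties being null, it is replaced by the measurable map
`selection`, and all computations take place on a product of identically structured spaces, one per
mobile. -/

noncomputable section

namespace FiniteRateFeedback

/-! ### Resampling one coordinate, and laws of doubly indexed families. -/

section ProductMeasures

/-- Replacing one coordinate of a random point of a product space by an independent copy does not
change its law. -/
theorem measurePreserving_update {ι : Type*} [Fintype ι] [DecidableEq ι] {X : ι → Type*}
    [∀ i, MeasurableSpace (X i)] (μ : ∀ i, Measure (X i)) [∀ i, IsProbabilityMeasure (μ i)]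
    (i : ι) :
    MeasurePreserving (fun p : X i × (∀ k, X k) => Function.update p.2 i p.1)
      ((μ i).prod (Measure.pi μ)) (Measure.pi μ) := by
  have hm : Measurable (fun p : X i × (∀ k, X k) => Function.update p.2 i p.1) := by
    refine measurable_pi_lambda _ fun k => ?_
    by_cases hk : k = i
    · subst hk; simpa using measurable_fst
    · simp only [Function.update_of_ne hk]
      exact (measurable_pi_apply k).comp measurable_snd
  refine ⟨hm, (Measure.pi_eq fun s hs => ?_).symm⟩
  rw [Measure.map_apply hm (.univ_pi hs)]
  -- The overwritten coordinate of `p.2` is unconstrained and contributes a factor one.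
  have : (fun p : X i × (∀ k, X k) => Function.update p.2 i p.1) ⁻¹' Set.univ.pi s
      = s i ×ˢ Set.univ.pi (Function.update s i Set.univ) := by
    ext ⟨x, y⟩
    simp only [Set.mem_preimage, Set.mem_pi, Set.mem_univ, true_implies, Set.mem_prod]
    constructor
    · intro h
      refine ⟨by simpa using h i, fun k => ?_⟩
      by_cases hk : k = i
      · subst hk; simp
      · simpa [hk] using h k
    · rintro ⟨h1, h2⟩ k
      by_cases hk : k = i
      · subst hk; simpa using h1
      · simpa [hk] using h2 k
  rw [this, Measure.prod_prod, Measure.pi_pi, ← Finset.mul_prod_erase _ _ (Finset.mem_univ i),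
    ← Finset.mul_prod_erase Finset.univ (fun k => μ k (s k)) (Finset.mem_univ i)]
  simp only [Function.update_self, measure_univ, one_mul]
  congr 1
  exact Finset.prod_congr rfl fun k hk => by
    rw [Function.update_of_ne (Finset.ne_of_mem_erase hk)]

/-- The joint law of a doubly indexed independent family, as an iterated product. -/
theorem map_eq_pi_pi_of_iIndepFun {Ω ι κ X : Type*} [MeasurableSpace Ω] [MeasurableSpace X]
    [Fintype ι] [Fintype κ] {μ : Measure Ω} [IsProbabilityMeasure μ] {f : ι → κ → Ω → X}
    (hf : ∀ i j, Measurable (f i j)) (h : iIndepFun (fun (p : ι × κ) ω => f p.1 p.2 ω) μ) :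
    μ.map (fun ω i j => f i j ω) = Measure.pi fun i => Measure.pi fun j => μ.map (f i j) := by
  have hP : ∀ i j, IsProbabilityMeasure (μ.map (f i j)) :=
    fun i j => Measure.isProbabilityMeasure_map (hf i j).aemeasurable
  have h1 := h.map_fun_eq_pi_map fun p : ι × κ => (hf p.1 p.2).aemeasurable
  have h2 := Measure.infinitePi_map_curry (fun i j => μ.map (f i j))
  rw [Measure.infinitePi_eq_pi, Measure.infinitePi_eq_pi] at h2
  simp only [Measure.infinitePi_eq_pi] at h2
  rw [← h2, ← h1, Measure.map_map (by fun_prop) (by fun_prop)]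
  rfl

end ProductMeasures

/-! ### Linear independence of random vectors, and orthonormal bases with prescribed members. -/

section Geometry

variable {V : Type*} [NormedAddCommGroup V] [InnerProductSpace ℂ V] [FiniteDimensional ℂ V]

/-- A measure which does not charge the hyperplanes through the origin. -/
def NullOnHyperplanes [MeasurableSpace V] (ν : Measure V) : Prop :=
  ∀ a : V, a ≠ 0 → ν {x | inner ℂ a x = 0} = 0

/-- Independent random vectors whose laws do not charge hyperplanes are almost surely linearly
independent. -/
theorem ae_linearIndependent [MeasurableSpace V] [BorelSpace V] {n : ℕ}
    (hn : n ≤ Module.finrank ℂ V) (ν : Fin n → Measure V) [∀ i, IsProbabilityMeasure (ν i)]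
    (hν : ∀ i, NullOnHyperplanes (ν i)) :
    ∀ᵐ g ∂(Measure.pi ν), LinearIndependent ℂ g := by
  have hT : SecondCountableTopology V :=
    have := FiniteDimensional.proper ℂ V
    inferInstance
  induction n with
  | zero => exact ae_of_all _ fun g => linearIndependent_empty_type
  | succ n ih =>
    have ih' := ih (by omega) (fun j => ν ((0 : Fin (n + 1)).succAbove j)) (fun j => hν _)
    have hmp := (measurePreserving_piFinSuccAbove ν 0).symm
    have hmeas : MeasurableSet {g : Fin (n + 1) → V | LinearIndependent ℂ g} :=
      isOpen_setOfPred_linearIndependent.measurableSet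
    rw [← hmp.map_eq, ae_map_iff hmp.measurable.aemeasurable hmeas]
    refine (Measure.ae_prod_iff_ae_ae (hmp.measurable hmeas)).2 ?_
    -- Exchanging the order of the quantifiers fixes `g` first; the new vector then only has to
    -- avoid a hyperplane containing the span of `g`.
    refine (Measure.ae_ae_comm (p := fun x g => LinearIndependent ℂ
      ((MeasurableEquiv.piFinSuccAbove (fun _ => V) 0).symm (x, g))) (hmp.measurable hmeas)).2 ?_
    filter_upwards [ih'] with g hg
    have hlt : Module.finrank ℂ (Submodule.span ℂ (Set.range g)) < Module.finrank ℂ V :=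
      ((finrank_range_le_card g).trans (by simp)).trans_lt (Nat.lt_of_succ_le hn)
    have hbot : (Submodule.span ℂ (Set.range g))ᗮ ≠ ⊥ := fun h => by
      rw [Submodule.orthogonal_eq_bot_iff] at h
      rw [h, finrank_top] at hlt
      exact lt_irrefl _ hlt
    obtain ⟨a, ha, ha0⟩ := Submodule.exists_mem_ne_zero_of_ne_bot hbot
    have : ∀ᵐ x ∂(ν 0), inner ℂ a x ≠ 0 := by
      rw [ae_iff]; simpa using hν 0 a ha0
    filter_upwards [this] with x hx
    have hcons : (MeasurableEquiv.piFinSuccAbove (fun _ => V) 0).symm (x, g) = Fin.cons x g := by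
      simp only [MeasurableEquiv.piFinSuccAbove]
      simp
      rfl
    show LinearIndependent ℂ ((MeasurableEquiv.piFinSuccAbove (fun _ => V) 0).symm (x, g))
    rw [hcons, linearIndependent_finCons]
    exact ⟨hg, fun hmem => hx (Submodule.inner_left_of_mem_orthogonal hmem ha)⟩

/-- A unitary map between two vectors of norm one. -/
theorem exists_unitary_map_eq {u v : V} (hu : ‖u‖ = 1) (hv : ‖v‖ = 1) :
    ∃ U : V ≃ₗᵢ[ℂ] V, U u = v := by
  have hn : 0 < Module.finrank ℂ V := by
    have : Nontrivial V := ⟨u, 0, fun h => by simp [h] at hu⟩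
    exact Module.finrank_pos
  have key : ∀ w : V, ‖w‖ = 1 → ∃ b : OrthonormalBasis (Fin (Module.finrank ℂ V)) ℂ V,
      b ⟨0, hn⟩ = w := by
    intro w hw
    have := Orthonormal.exists_orthonormalBasis_extension_of_card_eq (𝕜 := ℂ) (E := V)
      (ι := Fin (Module.finrank ℂ V)) (by simp) (v := fun _ => w) (s := {⟨0, hn⟩}) (by
        refine ⟨fun i => by simpa using hw, fun i j hij => (hij (Subsingleton.elim _ _)).elim⟩)
    obtain ⟨b, hb⟩ := this
    exact ⟨b, hb _ rfl⟩
  obtain ⟨b, hb⟩ := key u hu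
  obtain ⟨c, hc⟩ := key v hv
  refine ⟨b.equiv c (Equiv.refl _), ?_⟩
  rw [← hb, ← hc]
  simp

/-- Two orthogonal vectors of norm one belong to an orthonormal basis. -/
theorem exists_orthonormalBasis_pair {ι : Type*} [Fintype ι]
    (hι : Module.finrank ℂ V = Fintype.card ι) {i j : ι} (hij : i ≠ j) {u v : V} (hu : ‖u‖ = 1)
    (hv : ‖v‖ = 1) (huv : inner ℂ u v = 0) :
    ∃ b : OrthonormalBasis ι ℂ V, b i = u ∧ b j = v := by
  classical
  have := Orthonormal.exists_orthonormalBasis_extension_of_card_eq (𝕜 := ℂ) (E := V)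
      hι (v := fun k => if k = i then u else v) (s := {i, j}) (by
        constructor
        · rintro ⟨k, hk⟩
          simp only [Set.domRestrict_apply]
          split_ifs <;> assumption
        · rintro ⟨k, hk⟩ ⟨l, hl⟩ hkl
          have hkl' : k ≠ l := fun h => hkl (Subtype.ext h)
          have hvu : inner ℂ v u = 0 := by rw [← inner_conj_symm, huv, map_zero]
          simp only [Set.domRestrict_apply]
          rcases hk with rfl | rfl <;> rcases hl with rfl | rfl
          · exact (hkl' rfl).elim
          · simpa [hij.symm] using huv
          · simpa [hij.symm] using hvu
          · exact (hkl' rfl).elim)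
  obtain ⟨b, hb⟩ := this
  exact ⟨b, by simpa using hb i (by simp), by simpa [hij.symm] using hb j (by simp)⟩

end Geometry

/-! ### The complex Gaussian: characteristic function, Laplace transform of the squared modulus,
tail. -/

section ComplexGaussian

theorem measurable_complex_mk : Measurable (fun p : ℝ × ℝ => (⟨p.1, p.2⟩ : ℂ)) :=
  Complex.measurableEquivRealProd.symm.measurable

instance : IsProbabilityMeasure complexGaussian :=
  Measure.isProbabilityMeasure_map measurable_complex_mk.aemeasurable

/-- The variance `1 / 2` of each real part produces the `4`. Dependence on `‖z‖ ^ 2` alone is what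
makes the product law unitarily invariant. -/
theorem charFun_complexGaussian (z : ℂ) :
    charFun complexGaussian z = Complex.exp (-(‖z‖ : ℂ) ^ 2 / 4) := by
  have h1 : ∀ t : ℝ, ∫ x, Complex.exp ((t * x : ℝ) * Complex.I) ∂(gaussianReal 0 (1 / 2)) =
      Complex.exp (-(t : ℂ) ^ 2 / 4) := by
    intro t
    have := charFun_gaussianReal (μ := 0) (v := 1 / 2) t
    rw [charFun_apply_real] at this
    simp only [Complex.ofReal_mul]
    rw [this]
    congr 1
    push_cast
    ring
  rw [charFun_apply, complexGaussian, integral_map measurable_complex_mk.aemeasurable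
    (by fun_prop)]
  have h2 : ∀ p : ℝ × ℝ, Complex.exp ((inner ℝ (⟨p.1, p.2⟩ : ℂ) z : ℝ) * Complex.I) =
      Complex.exp ((z.re * p.1 : ℝ) * Complex.I) * Complex.exp ((z.im * p.2 : ℝ) * Complex.I) := by
    intro p
    rw [← Complex.exp_add, ← add_mul, ← Complex.ofReal_add]
    congr 3
    simp [Complex.inner]
  simp_rw [h2]
  rw [integral_prod_mul (fun x : ℝ => Complex.exp ((z.re * x : ℝ) * Complex.I))
    (fun x : ℝ => Complex.exp ((z.im * x : ℝ) * Complex.I)), h1, h1, ← Complex.exp_add]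
  congr 1
  rw [← Complex.ofReal_pow ‖z‖, Complex.sq_norm, Complex.normSq_apply]
  push_cast
  ring

theorem integral_exp_neg_mul_norm_sq_complexGaussian {c : ℝ} (hc : 0 ≤ c) :
    ∫ z, Real.exp (-c * ‖z‖ ^ 2) ∂complexGaussian = 1 / (1 + c) := by
  have h1 : ∫ x, Real.exp (-c * x ^ 2) ∂(gaussianReal 0 (1 / 2)) = 1 / √(1 + c) := by
    rw [integral_gaussianReal_eq_integral_smul (by norm_num)]
    have : ∀ x : ℝ, gaussianPDFReal 0 (1 / 2) x • Real.exp (-c * x ^ 2) =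
        (√Real.pi)⁻¹ * Real.exp (-(1 + c) * x ^ 2) := by
      intro x
      rw [gaussianPDFReal, smul_eq_mul, mul_assoc, ← Real.exp_add]
      congr 3
      · push_cast; ring
      · push_cast; ring
    simp_rw [this]
    rw [integral_const_mul, integral_gaussian, Real.sqrt_div Real.pi_pos.le]
    have : √Real.pi ≠ 0 := (Real.sqrt_pos.2 Real.pi_pos).ne'
    field_simp
  rw [complexGaussian, integral_map measurable_complex_mk.aemeasurable (by fun_prop)]
  have h2 : ∀ p : ℝ × ℝ, Real.exp (-c * ‖(⟨p.1, p.2⟩ : ℂ)‖ ^ 2) =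
      Real.exp (-c * p.1 ^ 2) * Real.exp (-c * p.2 ^ 2) := by
    intro p
    rw [← Real.exp_add, Complex.sq_norm, Complex.normSq_apply]
    congr 1
    ring
  simp_rw [h2]
  rw [integral_prod_mul (fun x : ℝ => Real.exp (-c * x ^ 2)) (fun x : ℝ => Real.exp (-c * x ^ 2)),
    h1, div_mul_div_comm, Real.mul_self_sqrt (by positivity), one_mul]

theorem integrable_sq_gaussianReal (v : NNReal) :
    Integrable (fun x : ℝ => x ^ 2) (gaussianReal 0 v) :=
  (memLp_id_gaussianReal' (μ := 0) (v := v) 2 (by simp)).integrable_sq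

theorem integral_sq_gaussianReal (v : NNReal) : ∫ x, x ^ 2 ∂(gaussianReal 0 v) = v := by
  have := variance_id_gaussianReal (μ := 0) (v := v)
  rw [variance_of_integral_eq_zero aemeasurable_id (by simp)] at this
  simpa using this

theorem integrable_norm_sq_complexGaussian :
    Integrable (fun z : ℂ => ‖z‖ ^ 2) complexGaussian := by
  rw [complexGaussian, integrable_map_measure (by fun_prop) measurable_complex_mk.aemeasurable]
  have : (fun z : ℂ => ‖z‖ ^ 2) ∘ (fun p : ℝ × ℝ => (⟨p.1, p.2⟩ : ℂ)) =
      fun p => p.1 ^ 2 + p.2 ^ 2 := by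
    ext p
    simp only [Function.comp_apply, Complex.sq_norm, Complex.normSq_apply]
    ring
  rw [this]
  exact ((integrable_sq_gaussianReal _).comp_fst _).add ((integrable_sq_gaussianReal _).comp_snd _)

theorem integral_norm_sq_complexGaussian : ∫ z, ‖z‖ ^ 2 ∂complexGaussian = 1 := by
  rw [complexGaussian, integral_map measurable_complex_mk.aemeasurable (by fun_prop)]
  have : ∀ p : ℝ × ℝ, ‖(⟨p.1, p.2⟩ : ℂ)‖ ^ 2 = p.1 ^ 2 + p.2 ^ 2 := by
    intro p
    simp only [Complex.sq_norm, Complex.normSq_apply]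
    ring
  simp_rw [this]
  rw [integral_add ((integrable_sq_gaussianReal _).comp_fst _)
    ((integrable_sq_gaussianReal _).comp_snd _), integral_fun_fst (fun x : ℝ => x ^ 2),
    integral_fun_snd (fun x : ℝ => x ^ 2)]
  simp [integral_sq_gaussianReal]
  norm_num

theorem lintegral_Ioi_two_mul_exp_neg_sq {a : ℝ} (ha : 0 ≤ a) :
    ∫⁻ r in Set.Ioi a, ENNReal.ofReal (2 * r * Real.exp (-r ^ 2)) =
      ENNReal.ofReal (Real.exp (-a ^ 2)) := by
  have hd : ∀ x ∈ Set.Ici a, HasDerivAt (fun r : ℝ => -Real.exp (-r ^ 2))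
      (2 * x * Real.exp (-x ^ 2)) x := by
    intro x _
    have := ((hasDerivAt_pow 2 x).neg.exp).neg
    convert! this using 1
    simp
    ring
  have ht : Filter.Tendsto (fun r : ℝ => -Real.exp (-r ^ 2)) Filter.atTop (nhds 0) := by
    have : Filter.Tendsto (fun r : ℝ => Real.exp (-r ^ 2)) Filter.atTop (nhds 0) :=
      Real.tendsto_exp_atBot.comp
        (Filter.tendsto_neg_atTop_atBot.comp (Filter.tendsto_pow_atTop two_ne_zero))
    simpa using this.neg
  have hpos : ∀ x ∈ Set.Ioi a, 0 ≤ 2 * x * Real.exp (-x ^ 2) := fun x hx => by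
    have : 0 < x := ha.trans_lt hx
    positivity
  have hi := integrableOn_Ioi_deriv_of_nonneg' hd hpos ht
  have := integral_Ioi_of_hasDerivAt_of_nonneg' hd hpos ht
  rw [← ofReal_integral_eq_lintegral_ofReal hi ((ae_restrict_iff' measurableSet_Ioi).2
    (ae_of_all _ hpos)), this]
  simp

/-- The squared modulus of a complex Gaussian is exponentially distributed. -/
theorem complexGaussian_le_norm_sq {t : ℝ} (ht : 0 ≤ t) :
    complexGaussian {z | t ≤ ‖z‖ ^ 2} = ENNReal.ofReal (Real.exp (-t)) := by
  have hS : MeasurableSet {z : ℂ | t ≤ ‖z‖ ^ 2} := measurableSet_le (by fun_prop) (by fun_prop)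
  have hpdf : ∀ x y : ℝ, gaussianPDF 0 (1 / 2) x * gaussianPDF 0 (1 / 2) y =
      ENNReal.ofReal (Real.pi⁻¹ * Real.exp (-(x ^ 2 + y ^ 2))) := by
    intro x y
    rw [gaussianPDF, gaussianPDF, ← ENNReal.ofReal_mul (gaussianPDFReal_nonneg _ _ _)]
    congr 1
    rw [gaussianPDFReal, gaussianPDFReal, mul_mul_mul_comm, ← Real.exp_add, ← mul_inv]
    have : (2 * Real.pi * ((1 / 2 : NNReal) : ℝ)) = Real.pi := by push_cast; ring
    rw [this, Real.mul_self_sqrt Real.pi_pos.le]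
    congr 2
    push_cast
    ring
  rw [complexGaussian, Measure.map_apply measurable_complex_mk hS,
    gaussianReal_of_var_ne_zero _ (by norm_num), prod_withDensity (by fun_prop) (by fun_prop),
    withDensity_apply _ (measurable_complex_mk hS),
    ← lintegral_indicator (measurable_complex_mk hS), ← Measure.volume_eq_prod,
    ← lintegral_comp_polarCoord_symm]
  -- The joint density `π⁻¹ exp (-r ^ 2)` times the Jacobian `r` does not involve the angle; the
  -- constant `(2 * π)⁻¹` is split off to cancel the angular integral.
  have h1 : ∀ p ∈ polarCoord.target, ENNReal.ofReal p.1 •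
      ((fun p : ℝ × ℝ => (⟨p.1, p.2⟩ : ℂ)) ⁻¹' {z | t ≤ ‖z‖ ^ 2}).indicator
        (fun z => gaussianPDF 0 (1 / 2) z.1 * gaussianPDF 0 (1 / 2) z.2) (polarCoord.symm p) =
      (Set.Ici √t).indicator (fun r => ENNReal.ofReal ((2 * Real.pi)⁻¹)
        * ENNReal.ofReal (2 * r * Real.exp (-r ^ 2))) p.1 := by
    rintro ⟨r, θ⟩ hp
    have hr : 0 < r := hp.1
    have hsq : (r * Real.cos θ) ^ 2 + (r * Real.sin θ) ^ 2 = r ^ 2 := by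
      rw [mul_pow, mul_pow, ← mul_add, Real.cos_sq_add_sin_sq, mul_one]
    have hiff : (polarCoord.symm (r, θ) ∈
        ((fun p : ℝ × ℝ => (⟨p.1, p.2⟩ : ℂ)) ⁻¹' {z | t ≤ ‖z‖ ^ 2})) ↔ r ∈ Set.Ici √t := by
      simp only [polarCoord_symm_apply, Set.mem_preimage, Set.mem_ofPred_eq, Set.mem_Ici,
        Complex.sq_norm, Complex.normSq_apply]
      rw [← sq, ← sq, hsq, Real.sqrt_le_left hr.le]
    by_cases h : r ∈ Set.Ici √t
    · rw [Set.indicator_of_mem (hiff.2 h), Set.indicator_of_mem h]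
      simp only [polarCoord_symm_apply]
      rw [hpdf, hsq, smul_eq_mul, ← ENNReal.ofReal_mul hr.le, ← ENNReal.ofReal_mul (by positivity)]
      congr 1
      have := Real.pi_pos.ne'
      field_simp
    · rw [Set.indicator_of_notMem (fun h' => h (hiff.1 h')), Set.indicator_of_notMem h, smul_zero]
  rw [setLIntegral_congr_fun (polarCoord.open_target.measurableSet) h1, polarCoord_target,
    Measure.volume_eq_prod, ← Measure.prod_restrict]
  have hF : Measurable ((Set.Ici √t).indicator (fun r => ENNReal.ofReal ((2 * Real.pi)⁻¹)
        * ENNReal.ofReal (2 * r * Real.exp (-r ^ 2)))) :=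
    Measurable.indicator (by fun_prop) measurableSet_Ici
  refine (lintegral_prod _ (hF.comp measurable_fst).aemeasurable).trans ?_
  simp only [lintegral_const, Measure.restrict_apply, MeasurableSet.univ, Set.univ_inter,
    Real.volume_Ioo, Function.comp_apply]
  have hae : (Set.Ici √t ∩ Set.Ioi 0 : Set ℝ) =ᵐ[volume] Set.Ioi √t := by
    have h2 : (Set.Ioi √t ∩ Set.Ioi 0 : Set ℝ) = Set.Ioi √t := by
      rw [Set.Ioi_inter_Ioi, sup_eq_left.2 (Real.sqrt_nonneg t)]
    conv_rhs => rw [← h2]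
    exact Filter.EventuallyEq.inter Ioi_ae_eq_Ici.symm (Filter.EventuallyEq.refl _ _)
  rw [lintegral_mul_const _ hF, lintegral_indicator measurableSet_Ici,
    lintegral_const_mul _ (by fun_prop), Measure.restrict_restrict measurableSet_Ici,
    setLIntegral_congr hae, lintegral_Ioi_two_mul_exp_neg_sq (Real.sqrt_nonneg t),
    Real.sq_sqrt ht, mul_right_comm, ← ENNReal.ofReal_mul (by positivity)]
  have : (2 * Real.pi)⁻¹ * (Real.pi - -Real.pi) = 1 := by
    have := Real.pi_pos.ne'
    field_simp
    ring
  rw [this, ENNReal.ofReal_one, one_mul]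

end ComplexGaussian

/-! ### The Rayleigh law on `ℂ^M` and its unitary invariance. -/

section RayleighLaw

/-- The law of a vector of iid complex Gaussians. -/
def rayleighLaw (M : ℕ) : Measure (CVec M) :=
  (Measure.pi fun _ : Fin M => complexGaussian).map (WithLp.toLp 2)

variable {M : ℕ}

instance : IsProbabilityMeasure (rayleighLaw M) :=
  Measure.isProbabilityMeasure_map (by fun_prop)

theorem charFun_rayleighLaw (t : CVec M) :
    charFun (rayleighLaw M) t = Complex.exp (-(‖t‖ : ℂ) ^ 2 / 4) := by
  rw [rayleighLaw]
  refine (charFun_pi (E := fun _ : Fin M => ℂ) t).trans ?_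
  simp_rw [charFun_complexGaussian]
  rw [← Complex.exp_sum, ← Complex.ofReal_pow, EuclideanSpace.norm_sq_eq, ← Finset.sum_div]
  push_cast
  rw [Finset.sum_neg_distrib]

/-- The characteristic function depends only on the norm, which a unitary map preserves. -/
theorem rayleighLaw_map_unitary (U : CVec M ≃ₗᵢ[ℂ] CVec M) :
    (rayleighLaw M).map U = rayleighLaw M := by
  have hU : Measurable U := U.continuous.measurable
  have := Measure.isProbabilityMeasure_map (μ := rayleighLaw M) hU.aemeasurable
  refine Measure.ext_of_charFun (funext fun t => ?_)
  rw [charFun_rayleighLaw, ← U.symm.norm_map, ← charFun_rayleighLaw, charFun_apply, charFun_apply,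
    integral_map hU.aemeasurable (by fun_prop)]
  -- `charFun` uses the real inner product; polarization expresses it through norms, which `U`
  -- preserves.
  have : ∀ x, inner ℝ (U x) t = inner ℝ x (U.symm t) := by
    intro x
    have h1 := real_inner_eq_norm_add_mul_self_sub_norm_mul_self_sub_norm_mul_self_div_two
      (F := CVec M)
    rw [h1, h1, U.norm_map, U.symm.norm_map, ← U.norm_map (x + U.symm t), map_add,
      U.apply_symm_apply]
  simp_rw [this]

theorem integrable_norm_sq_rayleighLaw : Integrable (fun x => ‖x‖ ^ 2) (rayleighLaw M) := by
  rw [rayleighLaw, integrable_map_measure (by fun_prop) (by fun_prop)]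
  have : (fun x : CVec M => ‖x‖ ^ 2) ∘ (WithLp.toLp 2) = fun y => ∑ i, ‖y i‖ ^ 2 := by
    ext y
    simp [EuclideanSpace.norm_sq_eq]
  rw [this]
  exact integrable_finsetSum _ fun i _ => integrable_comp_eval (i := i)
    (μ := fun _ : Fin M => complexGaussian) (f := fun z : ℂ => ‖z‖ ^ 2)
    integrable_norm_sq_complexGaussian

theorem integral_norm_sq_rayleighLaw : ∫ x, ‖x‖ ^ 2 ∂(rayleighLaw M) = M := by
  rw [rayleighLaw, integral_map (by fun_prop) (by fun_prop)]
  simp_rw [EuclideanSpace.norm_sq_eq]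
  rw [integral_finsetSum _ fun i _ => integrable_comp_eval (i := i)
    (μ := fun _ : Fin M => complexGaussian) (f := fun z : ℂ => ‖z‖ ^ 2)
    integrable_norm_sq_complexGaussian]
  have : ∀ i : Fin M, ∫ y : Fin M → ℂ, ‖y i‖ ^ 2 ∂(Measure.pi fun _ : Fin M => complexGaussian)
      = 1 := fun i => by
    rw [← integral_norm_sq_complexGaussian]
    exact integral_comp_eval (μ := fun _ : Fin M => complexGaussian) (i := i)
      integrable_norm_sq_complexGaussian.aestronglyMeasurable
  simp [this]

end RayleighLaw

/-! ### The angle between a fixed direction and an isotropic vector. -/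

section Laws

variable {M : ℕ}

theorem complexGaussian_singleton_zero : complexGaussian {0} = 0 := by
  rw [complexGaussian, Measure.map_apply measurable_complex_mk (measurableSet_singleton _)]
  have := nullSingletonClass_gaussianReal (μ := 0) (v := 1 / 2) (by norm_num)
  refine measure_mono_null (t := {0} ×ˢ Set.univ) ?_ ?_
  · rintro ⟨x, y⟩ h
    have : (⟨x, y⟩ : ℂ) = 0 := h
    simpa using congrArg Complex.re this
  · rw [Measure.prod_prod, measure_singleton, zero_mul]

theorem rayleighLaw_map_apply (i : Fin M) :
    (rayleighLaw M).map (fun x => x i) = complexGaussian := by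
  rw [rayleighLaw, Measure.map_map (by fun_prop) (by fun_prop)]
  exact (measurePreserving_eval (fun _ : Fin M => complexGaussian) i).map_eq

theorem norm_inner_single {M : ℕ} (x : CVec M) (i : Fin M) :
    ‖inner ℂ x (EuclideanSpace.single i (1 : ℂ))‖ = ‖x i‖ := by
  rw [EuclideanSpace.inner_single_right]
  simp

/-- Every component of a Rayleigh fading vector along a vector of norm one is a unit variance
complex Gaussian. -/
theorem rayleighLaw_map_inner {u : CVec M} (hu : ‖u‖ = 1) :
    (rayleighLaw M).map (fun x => inner ℂ u x) = complexGaussian := by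
  obtain ⟨i⟩ : Nonempty (Fin M) := by
    by_contra h
    rw [not_nonempty_iff] at h
    have : u = 0 := Subsingleton.elim _ _
    simp [this] at hu
  obtain ⟨U, hU⟩ := exists_unitary_map_eq hu
    (show ‖(EuclideanSpace.single i (1 : ℂ) : CVec M)‖ = 1 by simp)
  have h : (fun x : CVec M => inner ℂ u x) = (fun x : CVec M => x i) ∘ U := by
    ext x
    rw [Function.comp_apply, ← U.inner_map_map, hU, EuclideanSpace.inner_single_left]
    simp
  rw [h, ← Measure.map_map (by fun_prop) U.continuous.measurable, rayleighLaw_map_unitary,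
    rayleighLaw_map_apply]

theorem exists_norm_eq_one_smul {a : CVec M} (ha : a ≠ 0) :
    ∃ u : CVec M, ‖u‖ = 1 ∧ a = (‖a‖ : ℂ) • u := by
  have : (‖a‖ : ℂ) ≠ 0 := by simpa using ha
  refine ⟨(‖a‖ : ℂ)⁻¹ • a, ?_, ?_⟩
  · rw [norm_smul, norm_inv, Complex.norm_real, norm_norm, inv_mul_cancel₀ (by simpa using ha)]
  · rw [smul_smul, mul_inv_cancel₀ this, one_smul]

theorem nullOnHyperplanes_rayleighLaw : NullOnHyperplanes (rayleighLaw M) := by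
  intro a ha
  obtain ⟨u, hu, hau⟩ := exists_norm_eq_one_smul ha
  have : {x | inner ℂ a x = 0} = (fun x => inner ℂ u x) ⁻¹' {0} := by
    ext x
    rw [hau]
    simp [ha]
  rw [this, ← Measure.map_apply (by fun_prop) (measurableSet_singleton _),
    rayleighLaw_map_inner hu, complexGaussian_singleton_zero]

theorem ae_rayleighLaw_ne_zero (hM : 0 < M) : ∀ᵐ x ∂(rayleighLaw M), x ≠ 0 := by
  have := nullOnHyperplanes_rayleighLaw (EuclideanSpace.single (⟨0, hM⟩ : Fin M) (1 : ℂ)) (by simp)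
  rw [ae_iff]
  refine measure_mono_null (fun x hx => ?_) this
  have : x = 0 := by simpa using hx
  simp [this]

/-- Given the other coordinates, `‖y i‖ ^ 2` is exponential, so the conditional probability is a
product of factors `exp (-c * ‖y k‖ ^ 2)`; each of the `M - 1` factors integrates to `1 / (1 + c)`.
-/
theorem measure_pi_complexGaussian_mul_sum_le (i : Fin M) {c : ℝ} (hc : 0 ≤ c) :
    (Measure.pi fun _ : Fin M => complexGaussian)
      {y | c * ∑ k ∈ Finset.univ.erase i, ‖y k‖ ^ 2 ≤ ‖y i‖ ^ 2} =
      ENNReal.ofReal ((1 / (1 + c)) ^ (M - 1)) := by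
  have hS : MeasurableSet {y : Fin M → ℂ |
      c * ∑ k ∈ Finset.univ.erase i, ‖y k‖ ^ 2 ≤ ‖y i‖ ^ 2} :=
    measurableSet_le (by fun_prop) (by fun_prop)
  have hmp := measurePreserving_update (fun _ : Fin M => complexGaussian) i
  rw [← hmp.measure_preimage hS.nullMeasurableSet, Measure.prod_apply_symm (hmp.measurable hS)]
  have h1 : ∀ y : Fin M → ℂ, complexGaussian ((fun z => (z, y)) ⁻¹'
      ((fun p : ℂ × (Fin M → ℂ) => Function.update p.2 i p.1) ⁻¹'
        {y | c * ∑ k ∈ Finset.univ.erase i, ‖y k‖ ^ 2 ≤ ‖y i‖ ^ 2})) =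
      ENNReal.ofReal (∏ k, if k = i then 1 else Real.exp (-c * ‖y k‖ ^ 2)) := by
    intro y
    have h2 : (fun z => (z, y)) ⁻¹'
      ((fun p : ℂ × (Fin M → ℂ) => Function.update p.2 i p.1) ⁻¹'
        {y | c * ∑ k ∈ Finset.univ.erase i, ‖y k‖ ^ 2 ≤ ‖y i‖ ^ 2}) =
        {z : ℂ | c * ∑ k ∈ Finset.univ.erase i, ‖y k‖ ^ 2 ≤ ‖z‖ ^ 2} := by
      ext z
      simp only [Set.mem_preimage, Set.mem_ofPred_eq, Function.update_self]
      rw [Finset.sum_congr rfl fun k hk => by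
        rw [Function.update_of_ne (Finset.ne_of_mem_erase hk)]]
    rw [h2, complexGaussian_le_norm_sq (by positivity), ← neg_mul, Finset.mul_sum, Real.exp_sum,
      ← Finset.mul_prod_erase _ _ (Finset.mem_univ i)]
    simp only [if_true, one_mul]
    congr 1
    exact Finset.prod_congr rfl fun k hk => by rw [if_neg (Finset.ne_of_mem_erase hk)]
  simp_rw [h1]
  have h3 : ∀ y : Fin M → ℂ, ∏ k, (if k = i then 1 else Real.exp (-c * ‖y k‖ ^ 2)) =
      ∏ k, (fun (k : Fin M) (z : ℂ) => if k = i then 1 else Real.exp (-c * ‖z‖ ^ 2)) k (y k) :=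
    fun y => rfl
  have hle : ∀ y : Fin M → ℂ, ∏ k, (if k = i then 1 else Real.exp (-c * ‖y k‖ ^ 2)) ≤ 1 := by
    intro y
    refine Finset.prod_le_one (fun k _ => by split_ifs <;> positivity) fun k _ => ?_
    split_ifs
    · exact le_rfl
    · refine Real.exp_le_one_iff.2 ?_
      have : 0 ≤ c * ‖y k‖ ^ 2 := by positivity
      linarith
  have hge : ∀ y : Fin M → ℂ, 0 ≤ ∏ k, (if k = i then 1 else Real.exp (-c * ‖y k‖ ^ 2)) :=
    fun y => Finset.prod_nonneg fun k _ => by split_ifs <;> positivity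
  have hmeas : Measurable fun y : Fin M → ℂ =>
      ∏ k, (if k = i then 1 else Real.exp (-c * ‖y k‖ ^ 2)) := by
    refine Finset.measurable_prod _ fun k _ => ?_
    split_ifs <;> fun_prop
  rw [← ofReal_integral_eq_lintegral_ofReal
    (Integrable.of_bound hmeas.aestronglyMeasurable 1 (ae_of_all _ fun y => by
      rw [Real.norm_of_nonneg (hge y)]; exact hle y)) (ae_of_all _ hge)]
  simp_rw [h3]
  rw [integral_fintype_prod_eq_prod (μ := fun _ : Fin M => complexGaussian)
    (fun (k : Fin M) (z : ℂ) => if k = i then 1 else Real.exp (-c * ‖z‖ ^ 2)),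
    ← Finset.mul_prod_erase _ _ (Finset.mem_univ i)]
  congr 1
  rw [Finset.prod_congr rfl (g := fun _ => 1 / (1 + c)) fun k hk => by
    simp only [if_neg (Finset.ne_of_mem_erase hk)]
    exact integral_exp_neg_mul_norm_sq_complexGaussian hc]
  simp

theorem rayleighLaw_mul_norm_sq_le (i : Fin M) {x : ℝ} (hx : 0 < x) (hx1 : x ≤ 1) :
    rayleighLaw M {g | (1 - x) * ‖g‖ ^ 2 ≤ ‖g i‖ ^ 2} = ENNReal.ofReal (x ^ (M - 1)) := by
  have hS : MeasurableSet {g : CVec M | (1 - x) * ‖g‖ ^ 2 ≤ ‖g i‖ ^ 2} :=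
    measurableSet_le (by fun_prop) (by fun_prop)
  -- Moving the `i`-th term of `‖g‖ ^ 2` to the right leaves `x * ‖g i‖ ^ 2`; this ratio is the
  -- resulting `c`, and `1 / (1 + c) = x`.
  have hc : 0 ≤ (1 - x) / x := div_nonneg (by linarith) hx.le
  rw [rayleighLaw, Measure.map_apply (by fun_prop) hS]
  have h1 : WithLp.toLp 2 ⁻¹' {g : CVec M | (1 - x) * ‖g‖ ^ 2 ≤ ‖g i‖ ^ 2} =
      {y : Fin M → ℂ | (1 - x) / x * ∑ k ∈ Finset.univ.erase i, ‖y k‖ ^ 2 ≤ ‖y i‖ ^ 2} := by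
    ext y
    simp only [Set.mem_preimage, Set.mem_ofPred_eq, EuclideanSpace.norm_sq_eq]
    rw [← Finset.add_sum_erase _ _ (Finset.mem_univ i), div_mul_eq_mul_div, div_le_iff₀ hx]
    constructor <;> intro h <;> linarith
  have h2 : 1 / (1 + (1 - x) / x) = x := by field_simp; ring
  rw [h1, measure_pi_complexGaussian_mul_sum_le i hc, h2]

variable {ν : Measure (CVec M)}

/-- An isotropic unit vector is correlated with a fixed direction as a fixed unit vector is with
the direction of a Rayleigh fading vector. -/
theorem IsIsotropic.measure_le_norm_inner_sq (hν : IsIsotropic ν) {u : CVec M} (hu : ‖u‖ = 1)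
    (i : Fin M) (t : ℝ) :
    ν {w | t ≤ ‖inner ℂ u w‖ ^ 2} = rayleighLaw M {g | t * ‖g‖ ^ 2 ≤ ‖g i‖ ^ 2} := by
  have := hν.isProbabilityMeasure
  have hS : MeasurableSet {p : CVec M × CVec M | t * ‖p.1‖ ^ 2 ≤ ‖inner ℂ p.1 p.2‖ ^ 2} :=
    measurableSet_le (by fun_prop) (by fun_prop)
  -- The joint event for independent Rayleigh `a` and isotropic `w` is evaluated twice. With `a`
  -- fixed, rotating `w` turns the direction of `a` into `u`.
  have h1 : ∀ᵐ a ∂(rayleighLaw M), ν {w | t * ‖a‖ ^ 2 ≤ ‖inner ℂ a w‖ ^ 2} =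
      ν {w | t ≤ ‖inner ℂ u w‖ ^ 2} := by
    filter_upwards [ae_rayleighLaw_ne_zero (Fin.pos i)] with a ha
    obtain ⟨v, hv, hav⟩ := exists_norm_eq_one_smul ha
    obtain ⟨U, hU⟩ := exists_unitary_map_eq hv hu
    conv_rhs => rw [← hν.map_unitary U]
    rw [Measure.map_apply U.continuous.measurable (measurableSet_le (by fun_prop) (by fun_prop))]
    congr 1
    ext w
    have hpos : 0 < ‖a‖ ^ 2 := by positivity
    have : ‖inner ℂ a w‖ ^ 2 = ‖inner ℂ u (U w)‖ ^ 2 * ‖a‖ ^ 2 := by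
      rw [← hU, U.inner_map_map]
      conv_lhs => rw [hav]
      rw [inner_smul_left, norm_mul]
      simp
      ring
    simp only [Set.mem_preimage, Set.mem_ofPred_eq]
    rw [this, mul_le_mul_iff_left₀ hpos]
  -- With the unit vector `b` fixed, rotating `a` turns `b` into the `i`-th basis vector. Fubini
  -- equates the two constants.
  have h2 : ∀ᵐ b ∂ν, rayleighLaw M {a | t * ‖a‖ ^ 2 ≤ ‖inner ℂ a b‖ ^ 2} =
      rayleighLaw M {g | t * ‖g‖ ^ 2 ≤ ‖g i‖ ^ 2} := by
    filter_upwards [hν.ae_norm_eq_one] with b hb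
    obtain ⟨U, hU⟩ := exists_unitary_map_eq hb
      (show ‖(EuclideanSpace.single i (1 : ℂ) : CVec M)‖ = 1 by simp)
    conv_rhs => rw [← rayleighLaw_map_unitary U]
    rw [Measure.map_apply U.continuous.measurable (measurableSet_le (by fun_prop) (by fun_prop))]
    congr 1
    ext a
    simp only [Set.mem_preimage, Set.mem_ofPred_eq]
    rw [← norm_inner_single (U a), ← hU, U.inner_map_map, U.norm_map]
  have h3 : ∫⁻ a, ν {w | t * ‖a‖ ^ 2 ≤ ‖inner ℂ a w‖ ^ 2} ∂(rayleighLaw M) =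
      ∫⁻ b, rayleighLaw M {a | t * ‖a‖ ^ 2 ≤ ‖inner ℂ a b‖ ^ 2} ∂ν :=
    (Measure.prod_apply hS).symm.trans (Measure.prod_apply_symm hS)
  rw [lintegral_congr_ae h1, lintegral_congr_ae h2] at h3
  simpa using h3

theorem IsIsotropic.measure_quantization_error_le (hν : IsIsotropic ν) (hM : 2 ≤ M) {u : CVec M}
    (hu : ‖u‖ = 1) {x : ℝ} (hx : 0 ≤ x) (hx1 : x ≤ 1) :
    ν {w | 1 - ‖inner ℂ u w‖ ^ 2 ≤ x} = ENNReal.ofReal (x ^ (M - 1)) := by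
  have key : ∀ y : ℝ, 0 < y → y ≤ 1 → ν {w | 1 - ‖inner ℂ u w‖ ^ 2 ≤ y} =
      ENNReal.ofReal (y ^ (M - 1)) := by
    intro y hy hy1
    rw [← rayleighLaw_mul_norm_sq_le (⟨0, by omega⟩ : Fin M) hy hy1,
      ← hν.measure_le_norm_inner_sq hu]
    congr 1
    ext w
    simp only [Set.mem_ofPred_eq]
    constructor <;> intro h <;> linarith
  -- The Gaussian computation divides by `x`, so the endpoint zero is reached by letting `y`
  -- decrease to `0`.
  rcases hx.eq_or_lt with rfl | hx
  · rw [zero_pow (by omega), ENNReal.ofReal_zero]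
    refine le_antisymm ?_ zero_le
    have ht : Filter.Tendsto (fun y : ℝ => ENNReal.ofReal (y ^ (M - 1))) (nhdsWithin 0 (Set.Ioi 0))
        (nhds 0) := by
      have : Continuous fun y : ℝ => ENNReal.ofReal (y ^ (M - 1)) :=
        ENNReal.continuous_ofReal.comp (by fun_prop)
      have := this.tendsto 0
      rw [zero_pow (by omega), ENNReal.ofReal_zero] at this
      exact this.mono_left nhdsWithin_le_nhds
    refine ge_of_tendsto ht ?_
    filter_upwards [Ioc_mem_nhdsGT (zero_lt_one (α := ℝ))] with y hy
    rw [← key y hy.1 hy.2]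
    exact measure_mono fun w hw => le_trans hw hy.1.le
  · exact key x hx hx1

/-- The `(M - 1)`-th power of the squared sine of the angle between a fixed direction and an
isotropic vector is uniformly distributed. -/
theorem IsIsotropic.map_quantization_error_pow (hν : IsIsotropic ν) (hM : 2 ≤ M) {u : CVec M}
    (hu : ‖u‖ = 1) :
    ν.map (fun w => (1 - ‖inner ℂ u w‖ ^ 2) ^ (M - 1)) = volume.restrict (Set.Icc 0 1) := by
  have := hν.isProbabilityMeasure
  have hmeas : Measurable (fun w : CVec M => (1 - ‖inner ℂ u w‖ ^ 2) ^ (M - 1)) := by fun_prop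
  have := Measure.isProbabilityMeasure_map (μ := ν) hmeas.aemeasurable
  have hm : M - 1 ≠ 0 := by omega
  have hb : ∀ᵐ w ∂ν, 0 ≤ 1 - ‖inner ℂ u w‖ ^ 2 := by
    filter_upwards [hν.ae_norm_eq_one] with w hw
    have := norm_inner_le_norm (𝕜 := ℂ) u w
    rw [hu, hw, one_mul] at this
    nlinarith [norm_nonneg (inner ℂ u w)]
  refine Measure.ext_of_Iic _ _ fun a => ?_
  rw [Measure.map_apply hmeas measurableSet_Iic, Measure.restrict_apply measurableSet_Iic]
  rcases lt_or_ge a 0 with ha | ha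
  · have h1 : Set.Iic a ∩ Set.Icc (0 : ℝ) 1 = ∅ := by
      ext y
      simp only [Set.mem_inter_iff, Set.mem_Iic, Set.mem_Icc, Set.mem_empty_iff_false, iff_false]
      rintro ⟨h1, h2, -⟩
      linarith
    rw [h1, measure_empty]
    have h2 : ∀ᵐ w ∂ν, ¬ (1 - ‖inner ℂ u w‖ ^ 2) ^ (M - 1) ≤ a := by
      filter_upwards [hb] with w hw
      exact not_le.2 (ha.trans_le (pow_nonneg hw _))
    rw [ae_iff] at h2
    simpa using! h2
  · have h1 : Set.Iic a ∩ Set.Icc (0 : ℝ) 1 = Set.Icc 0 (min a 1) := by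
      ext y
      simp only [Set.mem_inter_iff, Set.mem_Iic, Set.mem_Icc, le_min_iff]
      tauto
    have h0 : 0 ≤ min a 1 := le_min ha zero_le_one
    -- The threshold on the squared sine itself; the cap at `1` is harmless because the squared sine
    -- never exceeds `1`.
    set x : ℝ := (min a 1) ^ (((M - 1 : ℕ) : ℝ)⁻¹) with hxdef
    have hx0 : 0 ≤ x := Real.rpow_nonneg h0 _
    have hxm : x ^ (M - 1) = min a 1 := Real.rpow_inv_natCast_pow h0 hm
    have hx1 : x ≤ 1 := Real.rpow_le_one h0 (min_le_right _ _) (by positivity)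
    rw [h1, Real.volume_Icc, sub_zero, ← hxm, ← hν.measure_quantization_error_le hM hu hx0 hx1]
    refine measure_congr ?_
    filter_upwards [hb] with w hw
    refine propext ?_
    show (1 - ‖inner ℂ u w‖ ^ 2) ^ (M - 1) ≤ a ↔ 1 - ‖inner ℂ u w‖ ^ 2 ≤ x
    rw [← pow_le_pow_iff_left₀ hw hx0 hm, hxm, le_min_iff]
    exact ⟨fun h => ⟨h, pow_le_one₀ hw (by nlinarith [norm_nonneg (inner ℂ u w)])⟩, fun h => h.1⟩

/-- The uniform law has no atoms. This excludes ties between codewords and, with `r = 0`, mass on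
hyperplanes. -/
theorem IsIsotropic.measure_norm_inner_eq (hν : IsIsotropic ν) (hM : 2 ≤ M) {u : CVec M}
    (hu : ‖u‖ = 1) (r : ℝ) : ν {w | ‖inner ℂ u w‖ = r} = 0 := by
  have h := hν.map_quantization_error_pow hM hu
  have hmeas : Measurable (fun w : CVec M => (1 - ‖inner ℂ u w‖ ^ 2) ^ (M - 1)) := by fun_prop
  have h0 : ν.map (fun w => (1 - ‖inner ℂ u w‖ ^ 2) ^ (M - 1)) {(1 - r ^ 2) ^ (M - 1)} = 0 := by
    rw [h]; simp
  rw [Measure.map_apply hmeas (measurableSet_singleton _)] at h0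
  refine measure_mono_null (fun w hw => ?_) h0
  have hw' : ‖inner ℂ u w‖ = r := hw
  simp [hw']

theorem IsIsotropic.nullOnHyperplanes (hν : IsIsotropic ν) (hM : 2 ≤ M) :
    NullOnHyperplanes ν := by
  intro a ha
  obtain ⟨u, hu, hau⟩ := exists_norm_eq_one_smul ha
  refine measure_mono_null (fun w hw => ?_) (hν.measure_norm_inner_eq hM hu 0)
  have hw' : inner ℂ a w = 0 := hw
  rw [hau, inner_smul_left] at hw'
  simpa [ha] using hw'

end Laws

/-! ### The selected codeword: measurability, isotropy and mean quantization error. -/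

section Selection

variable {M N : ℕ}

open Classical in
/-- The codeword which is strictly better aligned with `h` than all the others (`0` if there is no
such codeword). -/
def selection (h : CVec M) (w : Fin N → CVec M) : CVec M :=
  ∑ j, if ∀ k, k ≠ j → ‖inner ℂ h (w k)‖ < ‖inner ℂ h (w j)‖ then w j else 0

theorem measurable_selection :
    Measurable fun p : CVec M × (Fin N → CVec M) => selection p.1 p.2 := by
  classical
  refine Finset.measurable_sum _ fun j _ => ?_
  refine Measurable.ite ?_ (by fun_prop) measurable_const
  have : {p : CVec M × (Fin N → CVec M) |
      ∀ k, k ≠ j → ‖inner ℂ p.1 (p.2 k)‖ < ‖inner ℂ p.1 (p.2 j)‖} =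
      ⋂ k, {p | k ≠ j → ‖inner ℂ p.1 (p.2 k)‖ < ‖inner ℂ p.1 (p.2 j)‖} := by
    ext p; simp
  rw [this]
  refine MeasurableSet.iInter fun k => ?_
  by_cases hk : k = j
  · simp [hk]
  · simp only [ne_eq, hk, not_false_eq_true, true_implies]
    exact measurableSet_lt (by fun_prop) (by fun_prop)

theorem measurable_selection_right (h : CVec M) :
    Measurable fun w : Fin N → CVec M => selection h w := by
  have h1 : Measurable fun w : Fin N → CVec M => (h, w) := measurable_prodMk_left
  have h2 := Measurable.comp (measurable_selection (M := M) (N := N)) h1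
  simpa only [Function.comp_def] using h2

/-- The choice depends only on moduli of inner products, which a common rotation leaves alone. -/
theorem selection_map_unitary (U : CVec M ≃ₗᵢ[ℂ] CVec M) (h : CVec M) (w : Fin N → CVec M) :
    selection (U h) (fun j => U (w j)) = U (selection h w) := by
  classical
  simp only [selection, map_sum, U.inner_map_map]
  exact Finset.sum_congr rfl fun j _ => by split_ifs <;> simp

/-- Without ties a maximizer is strict, so its summand is the only one that survives. This is how an
arbitrary feedback rule is replaced by a measurable one. -/
theorem selection_eq {h : CVec M} {w : Fin N → CVec M} {j : Fin N}
    (hties : ∀ k l, k ≠ l → ‖inner ℂ h (w k)‖ ≠ ‖inner ℂ h (w l)‖)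
    (hj : ∀ k, ‖inner ℂ h (w k)‖ ≤ ‖inner ℂ h (w j)‖) : selection h w = w j := by
  classical
  rw [selection, Finset.sum_eq_single j]
  · exact if_pos fun k hk => lt_of_le_of_ne (hj k) (hties k j hk)
  · intro k _ hk
    exact if_neg fun h' => (h' j hk.symm).not_ge (hj k)
  · simp

variable {ν : Fin N → Measure (CVec M)}

/-- Ties have probability zero. -/
theorem ae_norm_inner_ne (hν : ∀ j, IsIsotropic (ν j)) (hM : 2 ≤ M) {h : CVec M} (hh : h ≠ 0) :
    ∀ᵐ w ∂(Measure.pi ν), ∀ k l, k ≠ l → ‖inner ℂ h (w k)‖ ≠ ‖inner ℂ h (w l)‖ := by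
  have hP := fun j => (hν j).isProbabilityMeasure
  rw [ae_all_iff]; intro k
  rw [ae_all_iff]; intro l
  by_cases hkl : k = l
  · simp [hkl]
  have hS : MeasurableSet {w : Fin N → CVec M | ‖inner ℂ h (w k)‖ = ‖inner ℂ h (w l)‖} :=
    measurableSet_eq_fun (by fun_prop) (by fun_prop)
  have hmp := measurePreserving_update ν k
  obtain ⟨u, hu, hhu⟩ := exists_norm_eq_one_smul hh
  -- Resampling codeword `k` alone, a tie forces its correlation with `u` to take a prescribed
  -- value, an event of measure zero.
  have h0 : Measure.pi ν {w | ‖inner ℂ h (w k)‖ = ‖inner ℂ h (w l)‖} = 0 := by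
    rw [← hmp.measure_preimage hS.nullMeasurableSet, Measure.prod_apply_symm (hmp.measurable hS),
      lintegral_eq_zero_iff (measurable_measure_prodMk_right (hmp.measurable hS))]
    refine ae_of_all _ fun y => ?_
    refine measure_mono_null (fun x hx => ?_) ((hν k).measure_norm_inner_eq hM hu
      ‖inner ℂ u (y l)‖)
    have hx' : ‖inner ℂ h x‖ = ‖inner ℂ h (y l)‖ := by
      simpa [Function.update_of_ne (Ne.symm hkl)] using hx
    rw [hhu, inner_smul_left, inner_smul_left, norm_mul, norm_mul] at hx'
    have : ‖(starRingEnd ℂ) (‖h‖ : ℂ)‖ ≠ 0 := by simpa using hh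
    exact mul_left_cancel₀ this hx'
  have := measure_eq_zero_iff_ae_notMem.1 h0
  filter_upwards [this] with w hw _ h'
  exact hw h'

/-- Almost surely, the quantized direction is the codeword with any index attaining the maximum. -/
theorem ae_selection_eq (hν : ∀ j, IsIsotropic (ν j)) (hM : 2 ≤ M) {h : CVec M} (hh : h ≠ 0) :
    ∀ᵐ w ∂(Measure.pi ν), ∀ j, (∀ k, ‖inner ℂ h (w k)‖ ≤ ‖inner ℂ h (w j)‖) →
      selection h w = w j := by
  filter_upwards [ae_norm_inner_ne hν hM hh] with w hw j hj
  exact selection_eq hw hj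

theorem ae_norm_codeword_eq_one (hν : ∀ j, IsIsotropic (ν j)) :
    ∀ᵐ w ∂(Measure.pi ν), ∀ j, ‖w j‖ = 1 := by
  have hP := fun j => (hν j).isProbabilityMeasure
  exact ae_all_iff.2 fun j => Measure.tendsto_eval_ae_ae.eventually (hν j).ae_norm_eq_one

theorem ae_prod_of_ae_codebook (hν : ∀ j, IsIsotropic (ν j)) (hM : 0 < M)
    {p : CVec M → (Fin N → CVec M) → Prop}
    (hp : MeasurableSet {x : CVec M × (Fin N → CVec M) | p x.1 x.2})
    (h : ∀ h, h ≠ 0 → ∀ᵐ w ∂(Measure.pi ν), p h w) :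
    ∀ᵐ x ∂((rayleighLaw M).prod (Measure.pi ν)), p x.1 x.2 := by
  have hP := fun j => (hν j).isProbabilityMeasure
  rw [Measure.ae_prod_iff_ae_ae hp]
  filter_upwards [ae_rayleighLaw_ne_zero hM] with a ha using h a ha

theorem ae_prod_selection_eq (hν : ∀ j, IsIsotropic (ν j)) (hM : 2 ≤ M) :
    ∀ᵐ x ∂((rayleighLaw M).prod (Measure.pi ν)),
      ∀ j, (∀ k, ‖inner ℂ x.1 (x.2 k)‖ ≤ ‖inner ℂ x.1 (x.2 j)‖) →
      selection x.1 x.2 = x.2 j := by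
  refine ae_all_iff.2 fun j => ae_prod_of_ae_codebook (p := fun h w =>
    (∀ k, ‖inner ℂ h (w k)‖ ≤ ‖inner ℂ h (w j)‖) → selection h w = w j) hν (by omega) ?_
    fun h hh => by
      filter_upwards [ae_selection_eq hν hM hh] with w hw using hw j
  have h1 : MeasurableSet {x : CVec M × (Fin N → CVec M) |
      ∀ k, ‖inner ℂ x.1 (x.2 k)‖ ≤ ‖inner ℂ x.1 (x.2 j)‖} := by
    have : {x : CVec M × (Fin N → CVec M) |
        ∀ k, ‖inner ℂ x.1 (x.2 k)‖ ≤ ‖inner ℂ x.1 (x.2 j)‖} =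
        ⋂ k, {x | ‖inner ℂ x.1 (x.2 k)‖ ≤ ‖inner ℂ x.1 (x.2 j)‖} := by
      ext p; simp
    rw [this]
    exact MeasurableSet.iInter fun k => measurableSet_le (by fun_prop) (by fun_prop)
  exact h1.imp (measurableSet_eq_fun measurable_selection (by fun_prop))

/-- Rotating the channel and all codewords together preserves their joint law and commutes with
`selection`. -/
theorem isIsotropic_map_selection [Nonempty (Fin N)] (hν : ∀ j, IsIsotropic (ν j)) (hM : 2 ≤ M) :
    IsIsotropic (((rayleighLaw M).prod (Measure.pi ν)).map fun x => selection x.1 x.2) := by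
  have hP := fun j => (hν j).isProbabilityMeasure
  refine ⟨Measure.isProbabilityMeasure_map measurable_selection.aemeasurable, ?_, fun U => ?_⟩
  · rw [ae_map_iff measurable_selection.aemeasurable (measurableSet_eq_fun (by fun_prop)
      measurable_const)]
    have h1 : ∀ᵐ x ∂((rayleighLaw M).prod (Measure.pi ν)), ∀ j, ‖x.2 j‖ = 1 :=
      Measure.quasiMeasurePreserving_snd.ae (ae_norm_codeword_eq_one hν)
    filter_upwards [ae_prod_selection_eq hν hM, h1] with x hx hx1
    obtain ⟨j, hj⟩ := Finite.exists_max fun j => ‖inner ℂ x.1 (x.2 j)‖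
    rw [hx j hj, hx1 j]
  · have hU : Measurable U := U.continuous.measurable
    have hmp : MeasurePreserving (Prod.map U fun (w : Fin N → CVec M) j => U (w j))
        ((rayleighLaw M).prod (Measure.pi ν)) ((rayleighLaw M).prod (Measure.pi ν)) :=
      MeasurePreserving.prod ⟨hU, rayleighLaw_map_unitary U⟩
        (measurePreserving_pi ν ν fun j => ⟨hU, (hν j).map_unitary U⟩)
    conv_rhs => rw [← hmp.map_eq]
    rw [Measure.map_map hU measurable_selection, Measure.map_map measurable_selection
      hmp.measurable]
    congr 1
    ext1 x
    exact (selection_map_unitary U x.1 x.2).symm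

/-- The mean of the minimum of `N + 1` uniforms, as the integral of its tail. The positive exponent
makes the integrand vanish beyond `1`. -/
theorem integral_max_one_sub_pow (N : ℕ) :
    ∫ t in Set.Ioi (0 : ℝ), (max (1 - t) 0) ^ (N + 1) = 1 / (N + 2) := by
  rw [setIntegral_eq_of_subset_of_forall_sdiff_eq_zero (s := Set.Ioc 0 1) measurableSet_Ioi
    (fun x hx => hx.1) (fun x hx => ?_), setIntegral_congr_fun measurableSet_Ioc
    (g := fun t => (1 - t) ^ (N + 1)) (fun t ht => by
      simp only [max_eq_left (sub_nonneg.2 ht.2)]), ← intervalIntegral.integral_of_le zero_le_one,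
    intervalIntegral.integral_comp_sub_left (fun x => x ^ (N + 1)) 1]
  · simp [integral_pow]
    ring
  · have h1 : 1 < x := by
      by_contra h
      exact hx.2 ⟨hx.1, not_lt.1 h⟩
    rw [max_eq_right (by linarith), zero_pow (by omega)]

/-- An upper bound for the mean squared sine of the angle between a channel and its quantization
with `N` codewords. -/
def quantizationErrorBound (M N : ℕ) : ℝ := (1 / (N + 1 : ℝ)) ^ (((M - 1 : ℕ) : ℝ)⁻¹)

/-- After taking `(M - 1)`-th powers this is `1 / (2 ^ B + 1) < 1 / 2 ^ B`, the source of strictness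
in the rate bound. -/
theorem quantizationErrorBound_lt (hM : 2 ≤ M) (B : ℕ) :
    quantizationErrorBound M (2 ^ B) < (2 : ℝ) ^ (-(B : ℝ) / ((M : ℝ) - 1)) := by
  have hm : M - 1 ≠ 0 := by omega
  have hcast : ((M - 1 : ℕ) : ℝ) = (M : ℝ) - 1 := by
    rw [Nat.cast_sub (by omega)]; simp
  have hm0 : (0 : ℝ) < (M : ℝ) - 1 := by
    rw [← hcast]; exact_mod_cast Nat.pos_of_ne_zero hm
  refine lt_of_pow_lt_pow_left₀ (M - 1) (by positivity) ?_
  rw [quantizationErrorBound, Real.rpow_inv_natCast_pow (by positivity) hm, ← Real.rpow_natCast,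
    ← Real.rpow_mul (by norm_num), hcast, div_mul_cancel₀ _ hm0.ne', Real.rpow_neg (by norm_num),
    Real.rpow_natCast, one_div]
  push_cast
  exact inv_strictAnti₀ (by positivity) (by linarith)

theorem quantizationErrorBound_nonneg (M N : ℕ) : 0 ≤ quantizationErrorBound M N :=
  Real.rpow_nonneg (by positivity) _

theorem norm_inner_sq_le_of_norm_le_one {x y : CVec M} (hy : ‖y‖ ≤ 1) :
    ‖inner ℂ x y‖ ^ 2 ≤ ‖x‖ ^ 2 := by
  have h1 := norm_inner_le_norm (𝕜 := ℂ) x y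
  have h2 : ‖inner ℂ x y‖ ≤ ‖x‖ := h1.trans (mul_le_of_le_one_right (norm_nonneg _) hy)
  exact pow_le_pow_left₀ (norm_nonneg _) h2 2

/-- The mean quantization error of random vector quantization. -/
theorem integral_quantization_error_le [Nonempty (Fin N)] (hν : ∀ j, IsIsotropic (ν j))
    (hM : 2 ≤ M) {h : CVec M} (hh : h ≠ 0) :
    ∫ w, (‖h‖ ^ 2 - ‖inner ℂ h (selection h w)‖ ^ 2) ∂(Measure.pi ν) ≤
      ‖h‖ ^ 2 * quantizationErrorBound M N := by
  have hP := fun j => (hν j).isProbabilityMeasure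
  have hm : M - 1 ≠ 0 := by omega
  obtain ⟨u, hu, hhu⟩ := exists_norm_eq_one_smul hh
  have hinner : ∀ x, ‖inner ℂ h x‖ = ‖h‖ * ‖inner ℂ u x‖ := fun x => by
    conv_lhs => rw [hhu]
    rw [inner_smul_left, norm_mul]
    simp
  have hhpos : 0 < ‖h‖ := norm_pos_iff.2 hh
  have hselm : Measurable fun w : Fin N → CVec M => selection h w :=
    measurable_selection_right h
  set V : (Fin N → CVec M) → ℝ := fun w => 1 - ‖inner ℂ u (selection h w)‖ ^ 2 with hV
  have hVm : Measurable V := by fun_prop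
  have heq : ∀ w, ‖h‖ ^ 2 - ‖inner ℂ h (selection h w)‖ ^ 2 = ‖h‖ ^ 2 * V w := fun w => by
    rw [hinner]; simp only [hV]; ring
  simp_rw [heq]
  rw [integral_const_mul]
  suffices hle : ∫ w, V w ∂(Measure.pi ν) ≤ quantizationErrorBound M N by gcongr
  have hsel : ∀ᵐ w ∂(Measure.pi ν), ∃ j, selection h w = w j ∧
      ∀ k, ‖inner ℂ u (w k)‖ ≤ ‖inner ℂ u (w j)‖ := by
    filter_upwards [ae_selection_eq hν hM hh] with w hw
    obtain ⟨j, hj⟩ := Finite.exists_max fun j => ‖inner ℂ h (w j)‖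
    refine ⟨j, hw j hj, fun k => ?_⟩
    have := hj k
    rw [hinner, hinner] at this
    exact le_of_mul_le_mul_left this hhpos
  have hnn : ∀ x : CVec M, ‖x‖ = 1 → 0 ≤ 1 - ‖inner ℂ u x‖ ^ 2 := fun x hx => by
    have := norm_inner_sq_le_of_norm_le_one (x := u) hx.le
    rw [hu, one_pow] at this
    linarith
  have hV01 : ∀ᵐ w ∂(Measure.pi ν), 0 ≤ V w ∧ V w ≤ 1 := by
    filter_upwards [hsel, ae_norm_codeword_eq_one hν] with w ⟨j, hj, _⟩ hw
    simp only [hV]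
    rw [hj]
    exact ⟨hnn _ (hw j), by nlinarith [norm_nonneg (inner ℂ u (w j))]⟩
  have hVint : Integrable V (Measure.pi ν) :=
    Integrable.of_bound hVm.aestronglyMeasurable 1 (by
      filter_upwards [hV01] with w hw
      rw [Real.norm_of_nonneg hw.1]; exact hw.2)
  have hVmint : Integrable (fun w => V w ^ (M - 1)) (Measure.pi ν) :=
    Integrable.of_bound (hVm.pow_const _).aestronglyMeasurable 1 (by
      filter_upwards [hV01] with w hw
      rw [Real.norm_of_nonneg (pow_nonneg hw.1 _)]; exact pow_le_one₀ hw.1 hw.2)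
  have htail : ∀ t ∈ Set.Ioi (0 : ℝ), (Measure.pi ν).real {w | t < V w ^ (M - 1)} =
      (max (1 - t) 0) ^ N := by
    intro t ht
    -- The selected error is the smallest, so it exceeds `t` exactly when all `N` independent errors
    -- do.
    have h1 : {w | t < V w ^ (M - 1)} =ᵐ[Measure.pi ν] Set.univ.pi fun _ : Fin N =>
        (fun x : CVec M => (1 - ‖inner ℂ u x‖ ^ 2) ^ (M - 1)) ⁻¹' (Set.Ioi t) := by
      rw [Filter.eventuallyEq_set]
      filter_upwards [hsel, ae_norm_codeword_eq_one hν] with w ⟨j, hj, hmax⟩ hw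
      simp only [hV, hj, Set.mem_pi, Set.mem_univ, true_implies, Set.mem_preimage, Set.mem_Ioi]
      refine ⟨fun h' k => h'.trans_le (pow_le_pow_left₀ (hnn _ (hw j)) ?_ _), fun h' => h' j⟩
      have := pow_le_pow_left₀ (norm_nonneg _) (hmax k) 2
      linarith
    have h2 : ∀ j, ν j ((fun x : CVec M => (1 - ‖inner ℂ u x‖ ^ 2) ^ (M - 1)) ⁻¹' (Set.Ioi t)) =
        ENNReal.ofReal (1 - t) := by
      intro j
      have hmeas : Measurable (fun w : CVec M => (1 - ‖inner ℂ u w‖ ^ 2) ^ (M - 1)) := by fun_prop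
      rw [← Measure.map_apply hmeas measurableSet_Ioi, (hν j).map_quantization_error_pow hM hu,
        Measure.restrict_apply measurableSet_Ioi]
      have : Set.Ioi t ∩ Set.Icc 0 1 = Set.Ioc t 1 := by
        ext y
        have : 0 < t := ht
        simp only [Set.mem_inter_iff, Set.mem_Ioi, Set.mem_Icc, Set.mem_Ioc]
        exact ⟨fun h => ⟨h.1, h.2.2⟩, fun h => ⟨h.1, (this.trans h.1).le, h.2⟩⟩
      rw [this, Real.volume_Ioc]
    rw [measureReal_congr h1, measureReal_def, Measure.pi_pi]
    simp_rw [h2]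
    simp [ENNReal.toReal_ofReal']
  have hmean : ∫ w, V w ^ (M - 1) ∂(Measure.pi ν) = 1 / (N + 1) := by
    rw [hVmint.integral_eq_integral_meas_lt (by
      filter_upwards [hV01] with w hw using pow_nonneg hw.1 _),
      setIntegral_congr_fun measurableSet_Ioi htail]
    obtain ⟨n, rfl⟩ : ∃ n, N = n + 1 :=
      ⟨N - 1, by have := Fin.pos (Classical.arbitrary (Fin N)); omega⟩
    rw [integral_max_one_sub_pow]
    push_cast
    ring
  -- Jensen for the convex power on `[0, ∞)` avoids computing the exact mean, a Beta function.
  have hjensen : (∫ w, V w ∂(Measure.pi ν)) ^ (M - 1) ≤ ∫ w, V w ^ (M - 1) ∂(Measure.pi ν) :=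
    (convexOn_pow (M - 1)).map_integral_le (continuous_pow _).continuousOn isClosed_Ici
      (by filter_upwards [hV01] with w hw using hw.1) hVint hVmint
  suffices hpow : (∫ w, V w ∂(Measure.pi ν)) ^ (M - 1) ≤ quantizationErrorBound M N ^ (M - 1) from
    le_of_pow_le_pow_left₀ hm (quantizationErrorBound_nonneg _ _) hpow
  rw [quantizationErrorBound, Real.rpow_inv_natCast_pow (by positivity) hm, ← hmean]
  exact hjensen

end Selection

/-! ### Algebra of zero-forcing beams, and the mean interference of one beam. -/

section ZeroForcing

variable {M : ℕ}

theorem concat_mulVec_apply (g : Fin M → CVec M) (x : CVec M) (i : Fin M) :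
    (concat g).mulVec x i = inner ℂ (g i) x := by
  rw [PiLp.inner_apply, Matrix.mulVec, dotProduct]
  refine Finset.sum_congr rfl fun k _ => ?_
  simp [concat, mul_comm]

theorem isUnit_det_concat_iff (g : Fin M → CVec M) :
    IsUnit (concat g).det ↔ LinearIndependent ℂ g := by
  have h1 : concat g = (Matrix.of fun i k => g i k).map (starRingEnd ℂ) := by
    ext i k
    simp [concat]
  rw [h1, ← RingHom.mapMatrix_apply, ← RingHom.map_det, isUnit_iff_ne_zero, map_ne_zero,
    ← isUnit_iff_ne_zero, ← Matrix.isUnit_iff_isUnit_det,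
    ← Matrix.linearIndependent_rows_iff_isUnit]
  have h2 : (Matrix.of fun i k => g i k).row = (WithLp.linearEquiv 2 ℂ (Fin M → ℂ)) ∘ g := rfl
  rw [h2]
  exact LinearMap.linearIndependent_iff (WithLp.linearEquiv 2 ℂ (Fin M → ℂ)).toLinearMap
    (LinearEquiv.ker _)

/-- The columns of the inverse of `concat g`. -/
def zfColumn (g : Fin M → CVec M) (j : Fin M) : CVec M :=
  WithLp.toLp 2 ((concat g)⁻¹.col j)

theorem zfBeam_eq (g : Fin M → CVec M) (j : Fin M) :
    zfBeam g j = ((‖zfColumn g j‖⁻¹ : ℝ) : ℂ) • zfColumn g j := rfl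

theorem inner_zfColumn {g : Fin M → CVec M} (hg : LinearIndependent ℂ g) (i j : Fin M) :
    inner ℂ (g i) (zfColumn g j) = if i = j then 1 else 0 := by
  rw [← concat_mulVec_apply, zfColumn, ← Matrix.one_apply,
    ← Matrix.mul_nonsing_inv _ ((isUnit_det_concat_iff g).2 hg)]
  rfl

theorem zfColumn_of_not_linearIndependent {g : Fin M → CVec M} (hg : ¬ LinearIndependent ℂ g)
    (j : Fin M) : zfColumn g j = 0 := by
  rw [← isUnit_det_concat_iff] at hg
  rw [zfColumn, Matrix.nonsing_inv_apply_not_isUnit _ hg]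
  ext k
  simp

theorem zfColumn_ne_zero {g : Fin M → CVec M} (hg : LinearIndependent ℂ g) (j : Fin M) :
    zfColumn g j ≠ 0 := fun h => by
  have := inner_zfColumn hg j j
  simp [h] at this

theorem norm_normalize_le_one {E : Type*} [NormedAddCommGroup E] [NormedSpace ℂ E] (c : E) :
    ‖((‖c‖⁻¹ : ℝ) : ℂ) • c‖ ≤ 1 := by
  rw [norm_smul, Complex.norm_real, norm_inv, norm_norm]
  exact inv_mul_le_one

theorem norm_normalize_eq_one {E : Type*} [NormedAddCommGroup E] [NormedSpace ℂ E] {c : E}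
    (hc : c ≠ 0) : ‖((‖c‖⁻¹ : ℝ) : ℂ) • c‖ = 1 := by
  rw [norm_smul, Complex.norm_real, norm_inv, norm_norm, inv_mul_cancel₀ (norm_ne_zero_iff.2 hc)]

theorem norm_zfBeam_le_one (g : Fin M → CVec M) (j : Fin M) : ‖zfBeam g j‖ ≤ 1 :=
  norm_normalize_le_one (zfColumn g j)

/-- The columns of the inverse are dual to `g`; in the singular case the beam is `0`, so no
invertibility is needed. -/
theorem inner_zfBeam_of_ne (g : Fin M → CVec M) {i j : Fin M} (hij : i ≠ j) :
    inner ℂ (g i) (zfBeam g j) = 0 := by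
  rw [zfBeam_eq, inner_smul_right]
  by_cases hg : LinearIndependent ℂ g
  · rw [inner_zfColumn hg, if_neg hij, mul_zero]
  · rw [zfColumn_of_not_linearIndependent hg, inner_zero_right, mul_zero]

/-- In the independent case a dual vector is determined by its inner products with the family; in
the dependent case both sides vanish. -/
theorem zfColumn_map_unitary (U : CVec M ≃ₗᵢ[ℂ] CVec M) (g : Fin M → CVec M) (j : Fin M) :
    zfColumn (fun k => U (g k)) j = U (zfColumn g j) := by
  have hiff : LinearIndependent ℂ (fun k => U (g k)) ↔ LinearIndependent ℂ g :=
    LinearMap.linearIndependent_iff U.toLinearEquiv.toLinearMap (LinearEquiv.ker _)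
  by_cases hg : LinearIndependent ℂ g
  · have hUg := hiff.2 hg
    have hinj := Matrix.mulVec_injective_of_isUnit ((Matrix.isUnit_iff_isUnit_det _).2
      ((isUnit_det_concat_iff _).2 hUg))
    have : (concat fun k => U (g k)).mulVec (zfColumn (fun k => U (g k)) j) =
        (concat fun k => U (g k)).mulVec (U (zfColumn g j)) := by
      ext i
      rw [concat_mulVec_apply, concat_mulVec_apply, inner_zfColumn hUg, U.inner_map_map,
        inner_zfColumn hg]
    exact WithLp.ofLp_injective 2 (hinj this)
  · rw [zfColumn_of_not_linearIndependent hg, zfColumn_of_not_linearIndependent (mt hiff.1 hg),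
      map_zero]

theorem zfBeam_map_unitary (U : CVec M ≃ₗᵢ[ℂ] CVec M) (g : Fin M → CVec M) (j : Fin M) :
    zfBeam (fun k => U (g k)) j = U (zfBeam g j) := by
  rw [zfBeam_eq, zfBeam_eq, zfColumn_map_unitary, U.norm_map, map_smul]

theorem continuous_concat : Continuous (concat : (Fin M → CVec M) → _) := by
  refine continuous_matrix fun i k => ?_
  simp only [concat, Matrix.of_apply]
  fun_prop

/-- The `j`-th column of the adjugate of `concat g`: a vector orthogonal to all `g i`, `i ≠ j`,
which does not depend on `g j`. -/
def zfAdjugate (g : Fin M → CVec M) (j : Fin M) : CVec M :=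
  WithLp.toLp 2 ((concat g).adjugate.col j)

/-- The direction of `zfAdjugate g j`. -/
def zfDirection (g : Fin M → CVec M) (j : Fin M) : CVec M :=
  ((‖zfAdjugate g j‖⁻¹ : ℝ) : ℂ) • zfAdjugate g j

theorem zfColumn_eq_smul (g : Fin M → CVec M) (j : Fin M) :
    zfColumn g j = (concat g).det⁻¹ • zfAdjugate g j := by
  rw [zfColumn, zfAdjugate, Matrix.inv_def, Ring.inverse_eq_inv']
  rfl

/-- The cofactors along row `j` do not involve row `j`. The inverse itself does, through the
determinant. -/
theorem zfDirection_update (g : Fin M → CVec M) (j : Fin M) (x : CVec M) :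
    zfDirection (Function.update g j x) j = zfDirection g j := by
  have : zfAdjugate (Function.update g j x) j = zfAdjugate g j := by
    ext k
    simp only [zfAdjugate, Matrix.col_apply, Matrix.adjugate_apply]
    congr 1
    ext a b
    by_cases ha : a = j
    · subst ha; simp
    · simp [Matrix.updateRow_ne ha, concat, Function.update_of_ne ha]
  rw [zfDirection, this, zfDirection]

theorem zfAdjugate_ne_zero {g : Fin M → CVec M} (hg : LinearIndependent ℂ g) (j : Fin M) :
    zfAdjugate g j ≠ 0 := fun h => by
  have := zfColumn_ne_zero hg j
  rw [zfColumn_eq_smul, h, smul_zero] at this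
  exact this rfl

theorem norm_zfDirection {g : Fin M → CVec M} (hg : LinearIndependent ℂ g) (j : Fin M) :
    ‖zfDirection g j‖ = 1 :=
  norm_normalize_eq_one (zfAdjugate_ne_zero hg j)

/-- Normalization removes the modulus of the determinant; only its phase distinguishes the two unit
vectors. -/
theorem norm_inner_zfBeam_eq {g : Fin M → CVec M} (hg : LinearIndependent ℂ g) (j : Fin M)
    (h : CVec M) : ‖inner ℂ h (zfBeam g j)‖ = ‖inner ℂ h (zfDirection g j)‖ := by
  have hd : ‖(concat g).det‖ ≠ 0 := norm_ne_zero_iff.2 ((isUnit_det_concat_iff g).2 hg).ne_zero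
  rw [zfBeam_eq, zfDirection, zfColumn_eq_smul, smul_smul, inner_smul_right, inner_smul_right,
    norm_mul, norm_mul, norm_mul, norm_smul]
  simp only [Complex.norm_real, norm_inv, norm_norm, norm_mul, mul_inv_rev, inv_inv]
  congr 1
  rw [mul_assoc, mul_inv_cancel₀ hd, mul_one]

theorem continuous_zfAdjugate (j : Fin M) :
    Continuous fun g : Fin M → CVec M => zfAdjugate g j :=
  (PiLp.continuous_toLp 2 _).comp
    (continuous_pi fun k => (continuous_concat.matrix_adjugate).matrix_elem k j)

theorem measurable_zfDirection (j : Fin M) :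
    Measurable fun g : Fin M → CVec M => zfDirection g j := by
  have h := (continuous_zfAdjugate (M := M) j).measurable
  have h1 : Measurable fun g : Fin M → CVec M => ((‖zfAdjugate g j‖⁻¹ : ℝ) : ℂ) :=
    Complex.measurable_ofReal.comp h.norm.inv
  exact h1.smul h

theorem measurable_zfBeam (j : Fin M) : Measurable fun g : Fin M → CVec M => zfBeam g j := by
  have h : Measurable fun g : Fin M → CVec M => zfColumn g j := by
    simp_rw [zfColumn_eq_smul]
    exact (continuous_concat.matrix_det.measurable.inv).smul (continuous_zfAdjugate j).measurable
  have h1 : Measurable fun g : Fin M → CVec M => ((‖zfColumn g j‖⁻¹ : ℝ) : ℂ) :=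
    Complex.measurable_ofReal.comp h.norm.inv
  exact h1.smul h

variable {η : Fin M → Measure (CVec M)}

theorem measurable_zfBeam_update (i j : Fin M) (w : CVec M) :
    Measurable fun g : Fin M → CVec M => zfBeam (Function.update g i w) j :=
  (measurable_zfBeam j).comp measurable_update_left

theorem integrable_norm_inner_zfBeam_update_sq (hη : ∀ k, IsIsotropic (η k)) (i j : Fin M)
    (w h : CVec M) : Integrable
      (fun g => ‖inner ℂ h (zfBeam (Function.update g i w) j)‖ ^ 2) (Measure.pi η) := by
  have hP := fun j => (hη j).isProbabilityMeasure
  have hm := measurable_zfBeam_update i j w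
  refine Integrable.of_bound (Measurable.aestronglyMeasurable (by fun_prop)) (‖h‖ ^ 2)
    (ae_of_all _ fun g => ?_)
  rw [Real.norm_of_nonneg (sq_nonneg _)]
  exact norm_inner_sq_le_of_norm_le_one (norm_zfBeam_le_one _ _)

/-- Rotate every `g k`: the law is invariant, the beam is equivariant, and the inserted vector `w`
stays put. -/
theorem integral_norm_inner_zfBeam_update_unitary (hη : ∀ k, IsIsotropic (η k)) (i j : Fin M)
    (w h : CVec M) (U : CVec M ≃ₗᵢ[ℂ] CVec M) (hU : U w = w) :
    ∫ g, ‖inner ℂ (U h) (zfBeam (Function.update g i w) j)‖ ^ 2 ∂(Measure.pi η) =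
      ∫ g, ‖inner ℂ h (zfBeam (Function.update g i w) j)‖ ^ 2 ∂(Measure.pi η) := by
  have hP := fun j => (hη j).isProbabilityMeasure
  have hmp : MeasurePreserving (fun (g : Fin M → CVec M) k => U (g k)) (Measure.pi η)
      (Measure.pi η) :=
    measurePreserving_pi η η fun k => ⟨U.continuous.measurable, (hη k).map_unitary U⟩
  have hm := measurable_zfBeam_update i j w
  conv_lhs => rw [← hmp.map_eq]
  rw [integral_map hmp.measurable.aemeasurable (Measurable.aestronglyMeasurable (by fun_prop))]
  refine integral_congr_ae (ae_of_all _ fun g => ?_)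
  have : Function.update (fun k => U (g k)) i w = fun k => U (Function.update g i w k) := by
    ext1 k
    by_cases hk : k = i
    · subst hk; simp [hU]
    · simp [hk]
  simp only [this, zfBeam_map_unitary, U.inner_map_map]

/-- Isotropy in the orthogonal complement of `w`: a unit vector orthogonal to `w` captures a
fraction of at most `1 / (M - 1)` of a beam which is orthogonal to `w`. -/
theorem integral_norm_inner_zfBeam_update_le_of_orthogonal (hη : ∀ k, IsIsotropic (η k))
    {i j : Fin M} (hij : i ≠ j) {w e : CVec M} (hw : ‖w‖ = 1) (he : ‖e‖ = 1)
    (hwe : inner ℂ w e = 0) :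
    ((M : ℝ) - 1) * ∫ g, ‖inner ℂ e (zfBeam (Function.update g i w) j)‖ ^ 2 ∂(Measure.pi η) ≤
      1 := by
  have hP := fun j => (hη j).isProbabilityMeasure
  obtain ⟨b, hbi, hbj⟩ := exists_orthonormalBasis_pair (ι := Fin M) (by simp) hij hw he hwe
  have hk : ∀ k ∈ Finset.univ.erase i,
      ∫ g, ‖inner ℂ (b k) (zfBeam (Function.update g i w) j)‖ ^ 2 ∂(Measure.pi η) =
      ∫ g, ‖inner ℂ e (zfBeam (Function.update g i w) j)‖ ^ 2 ∂(Measure.pi η) := by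
    intro k hk
    have hki := Finset.ne_of_mem_erase hk
    -- The unitary exchanging `b j = e` and `b k` fixes `b i = w`, so all directions orthogonal to
    -- `w` collect the same mean energy; these energies sum to at most `1`.
    rw [← integral_norm_inner_zfBeam_update_unitary hη i j w (b k) (b.equiv b (Equiv.swap j k))]
    · simp [hbj]
    · conv_lhs => rw [← hbi]
      rw [OrthonormalBasis.equiv_apply_basis, Equiv.swap_apply_of_ne_of_ne hij hki.symm, hbi]
  have hcard : ((Finset.univ.erase i).card : ℝ) = (M : ℝ) - 1 := by
    rw [Finset.card_erase_of_mem (Finset.mem_univ i), Finset.card_univ, Fintype.card_fin,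
      Nat.cast_sub (Fin.pos i)]
    simp
  rw [← hcard, ← nsmul_eq_mul, ← Finset.sum_const, ← Finset.sum_congr rfl hk,
    ← integral_finsetSum _ fun k _ => integrable_norm_inner_zfBeam_update_sq hη i j w (b k)]
  have hle : ∀ g : Fin M → CVec M,
      ∑ k ∈ Finset.univ.erase i, ‖inner ℂ (b k) (zfBeam (Function.update g i w) j)‖ ^ 2 ≤ 1 := by
    intro g
    have h1 := b.sum_sq_norm_inner_right (zfBeam (Function.update g i w) j)
    have h2 := pow_le_one₀ (n := 2) (norm_nonneg _) (norm_zfBeam_le_one (Function.update g i w) j)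
    refine le_trans ?_ (h1.trans_le h2)
    exact Finset.sum_le_sum_of_subset_of_nonneg (Finset.erase_subset _ _)
      fun _ _ _ => sq_nonneg _
  calc _ ≤ ∫ _ : Fin M → CVec M, (1 : ℝ) ∂(Measure.pi η) :=
        integral_mono (integrable_finsetSum _ fun k _ =>
          integrable_norm_inner_zfBeam_update_sq hη i j w (b k)) (integrable_const _) hle
    _ = 1 := by simp

/-- The mean interference caused by the beam of mobile `j` to mobile `i`, when the quantized
channel of mobile `i` is `w` and its channel is `h`. -/
theorem integral_norm_inner_zfBeam_update_le (hη : ∀ k, IsIsotropic (η k)) (hM : 2 ≤ M)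
    {i j : Fin M} (hij : i ≠ j) {w : CVec M} (hw : ‖w‖ = 1) (h : CVec M) :
    ∫ g, ‖inner ℂ h (zfBeam (Function.update g i w) j)‖ ^ 2 ∂(Measure.pi η) ≤
      (‖h‖ ^ 2 - ‖inner ℂ h w‖ ^ 2) / ((M : ℝ) - 1) := by
  have hM1 : (0 : ℝ) < (M : ℝ) - 1 := by
    have : (2 : ℝ) ≤ M := by exact_mod_cast hM
    linarith
  set r : CVec M := h - inner ℂ w h • w with hr
  have hwr : inner ℂ w r = 0 := by
    rw [hr, inner_sub_right, inner_smul_right, inner_self_eq_norm_sq_to_K, hw]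
    simp
  have hrn : ‖r‖ ^ 2 = ‖h‖ ^ 2 - ‖inner ℂ h w‖ ^ 2 := by
    have h1 : h = inner ℂ w h • w + r := by rw [hr]; abel
    have h2 : inner ℂ (inner ℂ w h • w) r = 0 := by rw [inner_smul_left, hwr, mul_zero]
    have h3 := norm_add_sq_eq_norm_sq_add_norm_sq_of_inner_eq_zero _ _ h2
    rw [← h1, norm_smul, hw, mul_one, ← norm_inner_symm h w] at h3
    rw [sq, sq, sq]
    linarith
  -- The beam of `j` is orthogonal to `w`, so only the residual `r` is seen.
  have heq : ∀ g : Fin M → CVec M, inner ℂ h (zfBeam (Function.update g i w) j) =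
      inner ℂ r (zfBeam (Function.update g i w) j) := by
    intro g
    have := inner_zfBeam_of_ne (Function.update g i w) hij
    rw [Function.update_self] at this
    rw [hr, inner_sub_left, inner_smul_left, this, mul_zero, sub_zero]
  simp_rw [heq]
  rw [← hrn]
  by_cases hr0 : r = 0
  · simp [hr0]
  · obtain ⟨e, he, hre⟩ := exists_norm_eq_one_smul hr0
    have hrc : (‖r‖ : ℂ) ≠ 0 := by simpa using hr0
    have hwe : inner ℂ w e = 0 := by
      rw [hre, inner_smul_right] at hwr
      exact (mul_eq_zero.1 hwr).resolve_left hrc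
    have h4 : ∀ x, ‖inner ℂ r x‖ ^ 2 = ‖r‖ ^ 2 * ‖inner ℂ e x‖ ^ 2 := fun x => by
      conv_lhs => rw [hre]
      rw [inner_smul_left, norm_mul, mul_pow]
      simp
    simp_rw [h4]
    rw [integral_const_mul, div_eq_mul_inv]
    gcongr
    rw [← one_div, le_div_iff₀ hM1, mul_comm]
    exact integral_norm_inner_zfBeam_update_le_of_orthogonal hη hij hw he hwe

end ZeroForcing

/-! ### Integrability and Jensen's inequality for logarithmic rates. -/

section LogRates

variable {X : Type*} [MeasurableSpace X] {μ : Measure X}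

theorem logb_two_one_add_nonneg {x : ℝ} (hx : 0 ≤ x) : 0 ≤ Real.logb 2 (1 + x) :=
  Real.logb_nonneg one_lt_two (by linarith)

theorem integrable_logb_one_add {f : X → ℝ} (hf : Integrable f μ) (h0 : ∀ x, 0 ≤ f x) :
    Integrable (fun x => Real.logb 2 (1 + f x)) μ := by
  have hm : AEStronglyMeasurable (fun x => Real.logb 2 (1 + f x)) μ :=
    ((Real.measurable_log.comp_aemeasurable
      (hf.aemeasurable.const_add 1)).div_const _).aestronglyMeasurable
  refine (hf.div_const (Real.log 2)).mono' hm (ae_of_all _ fun x => ?_)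
  rw [Real.norm_of_nonneg (logb_two_one_add_nonneg (h0 x)), Real.logb]
  have h2 : 0 < Real.log 2 := Real.log_pos one_lt_two
  gcongr
  have := Real.log_le_sub_one_of_pos (x := 1 + f x) (by linarith [h0 x])
  linarith

/-- Jensen's inequality for the rate function. -/
theorem integral_logb_one_add_le [IsProbabilityMeasure μ] {f : X → ℝ} (hf : Integrable f μ)
    (h0 : ∀ x, 0 ≤ f x) {c : ℝ} (hc : 0 ≤ c) (hfc : ∫ x, f x ∂μ ≤ c) :
    ∫ x, Real.logb 2 (1 + f x) ∂μ ≤ Real.logb 2 (1 + c) := by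
  have h2 : 0 < Real.log 2 := Real.log_pos one_lt_two
  have hc1 : 0 < 1 + c := by linarith
  -- The tangent line at `c`; its slope is positive, so `∫ f ≤ c` suffices in place of equality.
  have hpt : ∀ x, Real.logb 2 (1 + f x) ≤
      Real.logb 2 (1 + c) + (f x - c) * ((1 + c)⁻¹ / Real.log 2) := by
    intro x
    have hx : 0 < 1 + f x := by linarith [h0 x]
    have h3 := Real.log_le_sub_one_of_pos (div_pos hx hc1)
    rw [Real.log_div hx.ne' hc1.ne'] at h3
    have h4 : (1 + f x) / (1 + c) - 1 = (f x - c) * (1 + c)⁻¹ := by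
      field_simp
      ring
    rw [Real.logb, Real.logb, ← mul_div_assoc, ← add_div]
    gcongr
    linarith
  have hi : Integrable (fun x => f x - c) μ := hf.sub (integrable_const c)
  have hi' : Integrable (fun x => (f x - c) * ((1 + c)⁻¹ / Real.log 2)) μ := hi.mul_const _
  refine (integral_mono (integrable_logb_one_add hf h0) ((integrable_const _).add hi') hpt).trans ?_
  simp only [Pi.add_apply]
  rw [integral_add (integrable_const _) hi', integral_mul_const,
    integral_sub hf (integrable_const c)]
  simp only [integral_const, probReal_univ, one_smul]
  have : (∫ x, f x ∂μ - c) * ((1 + c)⁻¹ / Real.log 2) ≤ 0 :=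
    mul_nonpos_of_nonpos_of_nonneg (by linarith) (by positivity)
  linarith

/-- The rate with interference power `S` and signal power `s`. -/
theorem logb_one_add_div {s S : ℝ} (hs : 0 ≤ s) (hS : 0 ≤ S) :
    Real.logb 2 (1 + s) - Real.logb 2 (1 + S) ≤ Real.logb 2 (1 + s / (1 + S)) := by
  have h1 : 0 < 1 + S := by linarith
  rw [← Real.logb_div (by linarith) h1.ne']
  refine Real.logb_le_logb_of_le one_lt_two (by positivity) ?_
  rw [div_le_iff₀ h1, add_mul, div_mul_cancel₀ _ h1.ne']
  linarith

end LogRates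

/-! ### The product space of channels and codebooks: signal law and mean interference. -/

section CanonicalSpace

variable {M N : ℕ}

/-- The joint law of a channel and the codebook of a mobile. -/
def mobileLaw (ν : Fin N → Measure (CVec M)) : Measure (CVec M × (Fin N → CVec M)) :=
  (rayleighLaw M).prod (Measure.pi ν)

theorem isProbabilityMeasure_mobileLaw {ν : Fin N → Measure (CVec M)}
    (hν : ∀ j, IsIsotropic (ν j)) : IsProbabilityMeasure (mobileLaw ν) := by
  have hP := fun j => (hν j).isProbabilityMeasure
  unfold mobileLaw
  infer_instance

theorem mobileLaw_map_fst {ν : Fin N → Measure (CVec M)} (hν : ∀ j, IsIsotropic (ν j)) :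
    (mobileLaw ν).map Prod.fst = rayleighLaw M := by
  have hP := fun j => (hν j).isProbabilityMeasure
  rw [mobileLaw, Measure.map_fst_prod]
  simp

theorem ae_linearIndependent_pi {X : Type*} [MeasurableSpace X] {ρ : Fin M → Measure X}
    [∀ k, IsProbabilityMeasure (ρ k)] {G : X → CVec M} (hG : Measurable G)
    (h : ∀ k, NullOnHyperplanes ((ρ k).map G)) :
    ∀ᵐ x ∂(Measure.pi ρ), LinearIndependent ℂ fun k => G (x k) := by
  have := fun k => Measure.isProbabilityMeasure_map (μ := ρ k) hG.aemeasurable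
  have hmp : MeasurePreserving (fun (x : Fin M → X) k => G (x k)) (Measure.pi ρ)
      (Measure.pi fun k => (ρ k).map G) :=
    measurePreserving_pi _ _ fun k => ⟨hG, rfl⟩
  exact hmp.quasiMeasurePreserving.ae (ae_linearIndependent (by simp) _ h)

variable {ν : Fin M → Fin N → Measure (CVec M)}

/-- The component of the channel of mobile `i` along its zero-forcing beam, when the beam is
computed from the other mobiles' vectors, has the law of a single channel coefficient. -/
theorem map_norm_inner_zfBeam (hν : ∀ i j, IsIsotropic (ν i j))
    {G : CVec M × (Fin N → CVec M) → CVec M} (hG : Measurable G)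
    (h : ∀ k, NullOnHyperplanes ((mobileLaw (ν k)).map G)) (i : Fin M) :
    (Measure.pi fun k => mobileLaw (ν k)).map
        (fun x => ‖inner ℂ (x i).1 (zfBeam (fun k => G (x k)) i)‖) =
      complexGaussian.map fun z => ‖z‖ := by
  have hP := fun k => isProbabilityMeasure_mobileLaw (hν k)
  have hLI := ae_linearIndependent_pi hG h
  have hGm : Measurable fun (x : Fin M → CVec M × (Fin N → CVec M)) k => G (x k) :=
    measurable_pi_lambda _ fun k => hG.comp (measurable_pi_apply k)
  have hdm : Measurable fun x : Fin M → CVec M × (Fin N → CVec M) =>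
      zfDirection (fun k => G (x k)) i := (measurable_zfDirection i).comp hGm
  have hnm : Measurable fun x : Fin M → CVec M × (Fin N → CVec M) =>
      ‖inner ℂ (x i).1 (zfDirection (fun k => G (x k)) i)‖ := by
    have : Measurable fun x : Fin M → CVec M × (Fin N → CVec M) => (x i).1 :=
      measurable_fst.comp (measurable_pi_apply i)
    fun_prop
  -- `zfDirection` does not depend on mobile `i` at all, whereas the phase of `zfBeam` does.
  rw [Measure.map_congr (g := fun x => ‖inner ℂ (x i).1 (zfDirection (fun k => G (x k)) i)‖)
    (by filter_upwards [hLI] with x hx using norm_inner_zfBeam_eq hx i _)]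
  ext s hs
  have hmp := measurePreserving_update (fun k => mobileLaw (ν k)) i
  rw [Measure.map_apply hnm hs, ← hmp.measure_preimage (hnm hs).nullMeasurableSet,
    Measure.prod_apply_symm (hmp.measurable (hnm hs))]
  -- Given the other mobiles the direction is a fixed unit vector, and the resampled channel is
  -- Rayleigh.
  have hy : ∀ᵐ y ∂(Measure.pi fun k => mobileLaw (ν k)),
      mobileLaw (ν i) ((fun x => (x, y)) ⁻¹' ((fun p : (CVec M × (Fin N → CVec M)) ×
        (Fin M → CVec M × (Fin N → CVec M)) => Function.update p.2 i p.1) ⁻¹'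
          ((fun x => ‖inner ℂ (x i).1 (zfDirection (fun k => G (x k)) i)‖) ⁻¹' s))) =
        complexGaussian.map (fun z => ‖z‖) s := by
    filter_upwards [hLI] with y hy
    have hd := norm_zfDirection hy i
    have h1 : (fun x => (x, y)) ⁻¹' ((fun p : (CVec M × (Fin N → CVec M)) ×
        (Fin M → CVec M × (Fin N → CVec M)) => Function.update p.2 i p.1) ⁻¹'
          ((fun x => ‖inner ℂ (x i).1 (zfDirection (fun k => G (x k)) i)‖) ⁻¹' s)) =
        Prod.fst ⁻¹' ((fun a => inner ℂ (zfDirection (fun k => G (y k)) i) a) ⁻¹'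
          ((fun z : ℂ => ‖z‖) ⁻¹' s)) := by
      ext x
      have h2 : (fun k => G (Function.update y i x k)) =
          Function.update (fun k => G (y k)) i (G x) := by
        ext1 k
        by_cases hk : k = i
        · subst hk; simp
        · simp [hk]
      simp only [Set.mem_preimage, Function.update_self, h2, zfDirection_update]
      rw [norm_inner_symm]
    have hs' : MeasurableSet ((fun z : ℂ => ‖z‖) ⁻¹' s) := measurable_norm hs
    have him : Measurable fun a => inner ℂ (zfDirection (fun k => G (y k)) i) a := by fun_prop
    rw [h1, ← Measure.map_apply measurable_fst (him hs'), mobileLaw_map_fst (hν i),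
      ← Measure.map_apply him hs', rayleighLaw_map_inner hd, Measure.map_apply measurable_norm hs]
  rw [lintegral_congr_ae hy]
  simp

/-- The right side is free of `G`: taking `G` to be the channel or its quantization gives equal
means. -/
theorem integral_comp_norm_inner_zfBeam (hν : ∀ i j, IsIsotropic (ν i j))
    {G : CVec M × (Fin N → CVec M) → CVec M} (hG : Measurable G)
    (h : ∀ k, NullOnHyperplanes ((mobileLaw (ν k)).map G)) (i : Fin M) {f : ℝ → ℝ}
    (hf : Measurable f) :
    ∫ x, f ‖inner ℂ (x i).1 (zfBeam (fun k => G (x k)) i)‖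
        ∂(Measure.pi fun k => mobileLaw (ν k)) = ∫ z, f ‖z‖ ∂complexGaussian := by
  have hGm : Measurable fun (x : Fin M → CVec M × (Fin N → CVec M)) k => G (x k) :=
    measurable_pi_lambda _ fun k => hG.comp (measurable_pi_apply k)
  have hzm : Measurable fun x : Fin M → CVec M × (Fin N → CVec M) =>
      zfBeam (fun k => G (x k)) i := (measurable_zfBeam i).comp hGm
  have hm : Measurable fun x : Fin M → CVec M × (Fin N → CVec M) =>
      ‖inner ℂ (x i).1 (zfBeam (fun k => G (x k)) i)‖ := by
    have : Measurable fun x : Fin M → CVec M × (Fin N → CVec M) => (x i).1 :=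
      measurable_fst.comp (measurable_pi_apply i)
    fun_prop
  rw [← integral_map hm.aemeasurable hf.aestronglyMeasurable, map_norm_inner_zfBeam hν hG h,
    integral_map measurable_norm.aemeasurable hf.aestronglyMeasurable]

theorem integrable_norm_sq_fst_mobileLaw {ν : Fin N → Measure (CVec M)}
    (hν : ∀ j, IsIsotropic (ν j)) : Integrable (fun x => ‖x.1‖ ^ 2) (mobileLaw ν) := by
  have hP := fun j => (hν j).isProbabilityMeasure
  exact integrable_norm_sq_rayleighLaw.comp_fst _

theorem integrable_norm_sq_channel (hν : ∀ i j, IsIsotropic (ν i j)) (i : Fin M) :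
    Integrable (fun x => ‖(x i).1‖ ^ 2) (Measure.pi fun k => mobileLaw (ν k)) := by
  have hP := fun k => isProbabilityMeasure_mobileLaw (hν k)
  exact integrable_comp_eval (i := i) (μ := fun k => mobileLaw (ν k))
    (f := fun x : CVec M × (Fin N → CVec M) => ‖x.1‖ ^ 2)
    (integrable_norm_sq_fst_mobileLaw (hν i))

/-- The received power along any measurable beam of norm at most one is integrable. -/
theorem integrable_norm_inner_sq (hν : ∀ i j, IsIsotropic (ν i j)) (i : Fin M)
    {v : (Fin M → CVec M × (Fin N → CVec M)) → CVec M} (hv : Measurable v)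
    (hv1 : ∀ x, ‖v x‖ ≤ 1) :
    Integrable (fun x => ‖inner ℂ (x i).1 (v x)‖ ^ 2) (Measure.pi fun k => mobileLaw (ν k)) := by
  have h1 : Measurable fun x : Fin M → CVec M × (Fin N → CVec M) => (x i).1 :=
    measurable_fst.comp (measurable_pi_apply i)
  refine (integrable_norm_sq_channel hν i).mono' (Measurable.aestronglyMeasurable (by fun_prop))
    (ae_of_all _ fun x => ?_)
  rw [Real.norm_of_nonneg (sq_nonneg _)]
  exact norm_inner_sq_le_of_norm_le_one (hv1 x)

/-- The quantized channels of all mobiles. -/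
def quantizedChannels (x : Fin M → CVec M × (Fin N → CVec M)) : Fin M → CVec M :=
  fun k => selection (x k).1 (x k).2

theorem measurable_quantizedChannels :
    Measurable (quantizedChannels : (Fin M → CVec M × (Fin N → CVec M)) → _) :=
  measurable_pi_lambda _ fun k => measurable_selection.comp (measurable_pi_apply k)

theorem quantizedChannels_update (x : Fin M → CVec M × (Fin N → CVec M)) (i : Fin M)
    (y : CVec M × (Fin N → CVec M)) :
    quantizedChannels (Function.update x i y) =
      Function.update (quantizedChannels x) i (selection y.1 y.2) := by
  ext1 k
  by_cases hk : k = i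
  · subst hk; simp [quantizedChannels]
  · simp [quantizedChannels, hk]

theorem integral_quantization_error_mobileLaw_le [Nonempty (Fin N)] (hM : 2 ≤ M)
    {ν : Fin N → Measure (CVec M)} (hν : ∀ j, IsIsotropic (ν j)) :
    ∫ x, (‖x.1‖ ^ 2 - ‖inner ℂ x.1 (selection x.1 x.2)‖ ^ 2) ∂(mobileLaw ν) ≤
      M * quantizationErrorBound M N := by
  have hP := fun j => (hν j).isProbabilityMeasure
  have hsel := measurable_selection (M := M) (N := N)
  have hm : Measurable fun x : CVec M × (Fin N → CVec M) =>
      ‖x.1‖ ^ 2 - ‖inner ℂ x.1 (selection x.1 x.2)‖ ^ 2 := by fun_prop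
  have hiso := isIsotropic_map_selection hν hM
  have h1 : ∀ᵐ x ∂(mobileLaw ν), ‖selection x.1 x.2‖ = 1 :=
    ae_of_ae_map hsel.aemeasurable hiso.ae_norm_eq_one
  have hint : Integrable (fun x : CVec M × (Fin N → CVec M) =>
      ‖x.1‖ ^ 2 - ‖inner ℂ x.1 (selection x.1 x.2)‖ ^ 2) (mobileLaw ν) := by
    refine (integrable_norm_sq_fst_mobileLaw hν).mono' hm.aestronglyMeasurable ?_
    filter_upwards [h1] with x hx
    have := norm_inner_sq_le_of_norm_le_one (x := x.1) hx.le
    rw [Real.norm_of_nonneg (by linarith)]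
    linarith [sq_nonneg ‖inner ℂ x.1 (selection x.1 x.2)‖]
  have hle : ∀ᵐ a ∂(rayleighLaw M),
      ∫ w, (‖a‖ ^ 2 - ‖inner ℂ a (selection a w)‖ ^ 2) ∂(Measure.pi ν) ≤
        ‖a‖ ^ 2 * quantizationErrorBound M N := by
    filter_upwards [ae_rayleighLaw_ne_zero (by omega)] with a ha using
      integral_quantization_error_le hν hM ha
  rw [mobileLaw] at hint ⊢
  rw [integral_prod _ hint]
  refine (integral_mono_ae hint.integral_prod_left
    (integrable_norm_sq_rayleighLaw.mul_const _) hle).trans ?_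
  rw [integral_mul_const, integral_norm_sq_rayleighLaw]

/-- Condition on the channel and codebook of mobile `i`: the other quantized directions remain
independent and isotropic, so the fixed-`w` bound applies and leaves the mean quantization error. -/
theorem integral_interference_le [Nonempty (Fin N)] (hM : 2 ≤ M)
    (hν : ∀ i j, IsIsotropic (ν i j)) {i j : Fin M} (hij : i ≠ j) :
    ∫ x, ‖inner ℂ (x i).1 (zfBeam (quantizedChannels x) j)‖ ^ 2
        ∂(Measure.pi fun k => mobileLaw (ν k)) ≤
      M * quantizationErrorBound M N / ((M : ℝ) - 1) := by
  have hP := fun k => isProbabilityMeasure_mobileLaw (hν k)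
  have hM1 : (0 : ℝ) < (M : ℝ) - 1 := by
    have : (2 : ℝ) ≤ M := by exact_mod_cast hM
    linarith
  have hsel := measurable_selection (M := M) (N := N)
  have hiso := fun k => isIsotropic_map_selection (hν k) hM
  set η : Fin M → Measure (CVec M) := fun k =>
    (mobileLaw (ν k)).map fun x => selection x.1 x.2
  have hqmp : MeasurePreserving (quantizedChannels : (Fin M → CVec M × (Fin N → CVec M)) → _)
      (Measure.pi fun k => mobileLaw (ν k)) (Measure.pi η) := by
    have hP' := fun k => (hiso k).isProbabilityMeasure
    exact measurePreserving_pi (fun k => mobileLaw (ν k)) η fun k => ⟨hsel, rfl⟩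
  have hint := integrable_norm_inner_sq hν i
    (v := fun x => zfBeam (quantizedChannels x) j)
    ((measurable_zfBeam j).comp measurable_quantizedChannels) fun x => norm_zfBeam_le_one _ _
  have hmp := measurePreserving_update (fun k => mobileLaw (ν k)) i
  have hint' := hmp.integrable_comp_of_integrable hint
  rw [Function.comp_def] at hint'
  have h0 : ∫ x, ‖inner ℂ (x i).1 (zfBeam (quantizedChannels x) j)‖ ^ 2
        ∂(Measure.pi fun k => mobileLaw (ν k)) = ∫ p, ‖inner ℂ ((Function.update p.2 i p.1) i).1
          (zfBeam (quantizedChannels (Function.update p.2 i p.1)) j)‖ ^ 2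
          ∂((mobileLaw (ν i)).prod (Measure.pi fun k => mobileLaw (ν k))) := by
    conv_lhs => rw [← hmp.map_eq]
    rw [integral_map hmp.measurable.aemeasurable (by rw [hmp.map_eq]; exact hint.1)]
  have h1 : ∀ᵐ x ∂(mobileLaw (ν i)), ‖selection x.1 x.2‖ = 1 :=
    ae_of_ae_map hsel.aemeasurable (hiso i).ae_norm_eq_one
  have hle : ∀ᵐ x ∂(mobileLaw (ν i)),
      ∫ y, ‖inner ℂ ((Function.update y i x) i).1
          (zfBeam (quantizedChannels (Function.update y i x)) j)‖ ^ 2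
          ∂(Measure.pi fun k => mobileLaw (ν k)) ≤
        (‖x.1‖ ^ 2 - ‖inner ℂ x.1 (selection x.1 x.2)‖ ^ 2) / ((M : ℝ) - 1) := by
    filter_upwards [h1] with x hx
    refine le_trans (le_of_eq ?_) (integral_norm_inner_zfBeam_update_le hiso hM hij hx x.1)
    rw [show (Measure.pi fun k => ((rayleighLaw M).prod (Measure.pi (ν k))).map
      fun x => selection x.1 x.2) = Measure.pi η from rfl, ← hqmp.map_eq,
      integral_map hqmp.measurable.aemeasurable]
    · refine integral_congr_ae (ae_of_all _ fun y => ?_)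
      simp only [Function.update_self, quantizedChannels_update]
    · have := measurable_zfBeam_update i j (selection x.1 x.2)
      exact Measurable.aestronglyMeasurable (by fun_prop)
  have hint2 : Integrable (fun x : CVec M × (Fin N → CVec M) =>
      (‖x.1‖ ^ 2 - ‖inner ℂ x.1 (selection x.1 x.2)‖ ^ 2) / ((M : ℝ) - 1)) (mobileLaw (ν i)) := by
    refine (Integrable.mono' (integrable_norm_sq_fst_mobileLaw (hν i))
      (Measurable.aestronglyMeasurable (by fun_prop)) ?_).div_const _
    filter_upwards [h1] with x hx
    have := norm_inner_sq_le_of_norm_le_one (x := x.1) hx.le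
    rw [Real.norm_of_nonneg (by linarith)]
    linarith [sq_nonneg ‖inner ℂ x.1 (selection x.1 x.2)‖]
  rw [h0, integral_prod _ hint']
  refine (integral_mono_ae hint'.integral_prod_left hint2 hle).trans ?_
  rw [integral_div]
  have := integral_quantization_error_mobileLaw_le hM (hν i)
  gcongr

end CanonicalSpace

/-! ### Rates on the product space and the loss per mobile. -/

section CanonicalRates

variable {M N : ℕ} {ν : Fin M → Fin N → Measure (CVec M)}

/-- The rate of mobile `i` under zero-forcing with perfect channel knowledge, as a function of the
channels and the codebooks. -/
def canonicalRateZF (P : ℝ) (i : Fin M) (x : Fin M → CVec M × (Fin N → CVec M)) : ℝ :=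
  Real.logb 2 (1 + P / M * ‖inner ℂ (x i).1 (zfBeam (fun k => (x k).1) i)‖ ^ 2)

/-- The rate of mobile `i` under zero-forcing on the quantized channels, as a function of the
channels and the codebooks. -/
def canonicalRateFB (P : ℝ) (i : Fin M) (x : Fin M → CVec M × (Fin N → CVec M)) : ℝ :=
  Real.logb 2 (1 + sinr P (fun k => (x k).1) (zfBeam (quantizedChannels x)) i)

theorem measurable_channels :
    Measurable fun (x : Fin M → CVec M × (Fin N → CVec M)) k => (x k).1 :=
  measurable_pi_lambda _ fun k => measurable_fst.comp (measurable_pi_apply k)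

theorem measurable_zfBeam_quantizedChannels (j : Fin M) :
    Measurable fun x : Fin M → CVec M × (Fin N → CVec M) => zfBeam (quantizedChannels x) j :=
  (measurable_zfBeam j).comp measurable_quantizedChannels

theorem integrable_canonicalRateZF (hν : ∀ i j, IsIsotropic (ν i j)) {P : ℝ} (hP : 0 < P)
    (i : Fin M) : Integrable (canonicalRateZF P i) (Measure.pi fun k => mobileLaw (ν k)) :=
  integrable_logb_one_add ((integrable_norm_inner_sq hν i
    ((measurable_zfBeam i).comp measurable_channels) fun _ => norm_zfBeam_le_one _ _).const_mul _)
    fun x => by positivity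

theorem integrable_signal (hν : ∀ i j, IsIsotropic (ν i j)) (P : ℝ) (i j : Fin M) :
    Integrable (fun x => P / M * ‖inner ℂ (x i).1 (zfBeam (quantizedChannels x) j)‖ ^ 2)
      (Measure.pi fun k => mobileLaw (ν k)) :=
  (integrable_norm_inner_sq hν i (measurable_zfBeam_quantizedChannels j)
    fun _ => norm_zfBeam_le_one _ _).const_mul _

theorem integrable_interference (hν : ∀ i j, IsIsotropic (ν i j)) (P : ℝ) (i : Fin M) :
    Integrable (fun x => ∑ j ∈ Finset.univ.erase i,
      P / M * ‖inner ℂ (x i).1 (zfBeam (quantizedChannels x) j)‖ ^ 2)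
      (Measure.pi fun k => mobileLaw (ν k)) :=
  integrable_finsetSum _ fun j _ => integrable_signal hν P i j

theorem sinr_nonneg {P : ℝ} (hP : 0 < P) (h v : Fin M → CVec M) (i : Fin M) :
    0 ≤ sinr P h v i := by
  rw [sinr]
  positivity

/-- The denominator of the SINR is at least `1`, so the integrable signal power dominates it. -/
theorem integrable_canonicalRateFB (hν : ∀ i j, IsIsotropic (ν i j)) {P : ℝ} (hP : 0 < P)
    (i : Fin M) : Integrable (canonicalRateFB P i) (Measure.pi fun k => mobileLaw (ν k)) := by
  refine integrable_logb_one_add ?_ fun x => sinr_nonneg hP _ _ _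
  refine (integrable_signal hν P i i).mono' ?_ (ae_of_all _ fun x => ?_)
  · exact ((integrable_signal hν P i i).aemeasurable.div
      ((integrable_interference hν P i).aemeasurable.const_add 1)).aestronglyMeasurable
  · rw [Real.norm_of_nonneg (sinr_nonneg hP _ _ _), sinr]
    refine div_le_self (by positivity) ?_
    have : 0 ≤ ∑ j ∈ Finset.univ.erase i,
      P / M * ‖inner ℂ (x i).1 (zfBeam (quantizedChannels x) j)‖ ^ 2 := by positivity
    linarith

theorem integral_interference_power_le [Nonempty (Fin N)] (hM : 2 ≤ M)
    (hν : ∀ i j, IsIsotropic (ν i j)) {P : ℝ} (hP : 0 < P) (i : Fin M) :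
    ∫ x, ∑ j ∈ Finset.univ.erase i,
      P / M * ‖inner ℂ (x i).1 (zfBeam (quantizedChannels x) j)‖ ^ 2
      ∂(Measure.pi fun k => mobileLaw (ν k)) ≤ P * quantizationErrorBound M N := by
  have hM2 : (2 : ℝ) ≤ M := by exact_mod_cast hM
  have hM1 : (0 : ℝ) < (M : ℝ) - 1 := by linarith
  have hM0 : (0 : ℝ) < M := by linarith
  rw [integral_finsetSum _ fun j _ => integrable_signal hν P i j]
  have hle : ∀ j ∈ Finset.univ.erase i,
      ∫ x, P / M * ‖inner ℂ (x i).1 (zfBeam (quantizedChannels x) j)‖ ^ 2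
        ∂(Measure.pi fun k => mobileLaw (ν k)) ≤
      P / M * (M * quantizationErrorBound M N / ((M : ℝ) - 1)) := by
    intro j hj
    rw [integral_const_mul]
    exact mul_le_mul_of_nonneg_left
      (integral_interference_le hM hν (Finset.ne_of_mem_erase hj).symm) (by positivity)
  refine (Finset.sum_le_sum hle).trans (le_of_eq ?_)
  rw [Finset.sum_const, Finset.card_erase_of_mem (Finset.mem_univ i), Finset.card_univ,
    Fintype.card_fin, nsmul_eq_mul, Nat.cast_sub (by omega)]
  push_cast
  field_simp

theorem nullOnHyperplanes_map_fst (hν : ∀ i j, IsIsotropic (ν i j)) (k : Fin M) :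
    NullOnHyperplanes ((mobileLaw (ν k)).map Prod.fst) := by
  rw [mobileLaw_map_fst (hν k)]
  exact nullOnHyperplanes_rayleighLaw

theorem nullOnHyperplanes_map_selection [Nonempty (Fin N)] (hM : 2 ≤ M)
    (hν : ∀ i j, IsIsotropic (ν i j)) (k : Fin M) :
    NullOnHyperplanes ((mobileLaw (ν k)).map fun x => selection x.1 x.2) :=
  (isIsotropic_map_selection (hν k) hM).nullOnHyperplanes hM

/-- The rate loss caused by the quantization of the channels. -/
theorem integral_canonicalRate_sub_lt {B : ℕ} {ν : Fin M → Fin (2 ^ B) → Measure (CVec M)}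
    (hM : 2 ≤ M) (hν : ∀ i j, IsIsotropic (ν i j)) {P : ℝ} (hP : 0 < P) (i : Fin M) :
    ∫ x, canonicalRateZF P i x ∂(Measure.pi fun k => mobileLaw (ν k)) -
      ∫ x, canonicalRateFB P i x ∂(Measure.pi fun k => mobileLaw (ν k)) <
    Real.logb 2 (1 + P * (2 : ℝ) ^ (-(B : ℝ) / ((M : ℝ) - 1))) := by
  have hN : Nonempty (Fin (2 ^ B)) := ⟨⟨0, by positivity⟩⟩
  have hPr := fun k => isProbabilityMeasure_mobileLaw (hν k)
  set s : (Fin M → CVec M × (Fin (2 ^ B) → CVec M)) → ℝ := fun x =>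
    P / M * ‖inner ℂ (x i).1 (zfBeam (quantizedChannels x) i)‖ ^ 2 with hs
  set S : (Fin M → CVec M × (Fin (2 ^ B) → CVec M)) → ℝ := fun x => ∑ j ∈ Finset.univ.erase i,
    P / M * ‖inner ℂ (x i).1 (zfBeam (quantizedChannels x) j)‖ ^ 2 with hS
  have hs0 : ∀ x, 0 ≤ s x := fun x => by positivity
  have hS0 : ∀ x, 0 ≤ S x := fun x => by positivity
  have his : Integrable (fun x => Real.logb 2 (1 + s x)) (Measure.pi fun k => mobileLaw (ν k)) :=
    integrable_logb_one_add (integrable_signal hν P i i) hs0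
  have hiS : Integrable (fun x => Real.logb 2 (1 + S x)) (Measure.pi fun k => mobileLaw (ν k)) :=
    integrable_logb_one_add (integrable_interference hν P i) hS0
  have hfm : Measurable fun r : ℝ => Real.logb 2 (1 + P / M * r ^ 2) :=
    (Real.measurable_log.comp (by fun_prop)).div_const _
  -- Both integrals equal the mean of the same function of the modulus of one complex Gaussian.
  have hZF : ∫ x, canonicalRateZF P i x ∂(Measure.pi fun k => mobileLaw (ν k)) =
      ∫ x, Real.logb 2 (1 + s x) ∂(Measure.pi fun k => mobileLaw (ν k)) :=
    (integral_comp_norm_inner_zfBeam hν measurable_fst (nullOnHyperplanes_map_fst hν) i hfm).trans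
      (integral_comp_norm_inner_zfBeam hν measurable_selection
        (nullOnHyperplanes_map_selection hM hν) i hfm).symm
  have hFB : ∫ x, (Real.logb 2 (1 + s x) - Real.logb 2 (1 + S x))
        ∂(Measure.pi fun k => mobileLaw (ν k)) ≤
      ∫ x, canonicalRateFB P i x ∂(Measure.pi fun k => mobileLaw (ν k)) :=
    integral_mono (his.sub hiS) (integrable_canonicalRateFB hν hP i)
      fun x => logb_one_add_div (hs0 x) (hS0 x)
  rw [integral_sub his hiS] at hFB
  have hJ := integral_logb_one_add_le (integrable_interference hν P i) hS0
    (mul_nonneg hP.le (quantizationErrorBound_nonneg M (2 ^ B)))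
    (integral_interference_power_le hM hν hP i)
  have hlt : Real.logb 2 (1 + P * quantizationErrorBound M (2 ^ B)) <
      Real.logb 2 (1 + P * (2 : ℝ) ^ (-(B : ℝ) / ((M : ℝ) - 1))) := by
    have := quantizationErrorBound_lt hM B
    have h0 := quantizationErrorBound_nonneg M (2 ^ B)
    refine Real.logb_lt_logb one_lt_two (by positivity) ?_
    gcongr
  linarith

end CanonicalRates

/-! ### From the given probability space to the product space. -/

section Transfer

variable {Ω : Type*} [MeasurableSpace Ω] {μ : Measure Ω} [IsProbabilityMeasure μ] {M B : ℕ}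
  {h : Fin M → Ω → CVec M} {W : Fin M → Fin (2 ^ B) → Ω → CVec M}
  {F : Fin M → Ω → Fin (2 ^ B)}

theorem measurePreserving_toLp_rayleighLaw :
    MeasurePreserving (WithLp.toLp 2 : (Fin M → ℂ) → CVec M)
      (Measure.pi fun _ => complexGaussian) (rayleighLaw M) := by
  refine ⟨by fun_prop, ?_⟩
  rw [rayleighLaw]

theorem IsRayleighFading.map_eq (hh : IsRayleighFading μ h) :
    μ.map (fun ω i => h i ω) = Measure.pi fun _ : Fin M => rayleighLaw M := by
  have hm : ∀ i k, Measurable fun ω => h i ω k := fun i k => by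
    have := hh.measurable i
    fun_prop
  have h1 := map_eq_pi_pi_of_iIndepFun (f := fun i k ω => h i ω k) hm hh.entry_indep
  simp only [hh.entry_law] at h1
  have hmp : MeasurePreserving (fun (y : Fin M → Fin M → ℂ) i => (WithLp.toLp 2 (y i) : CVec M))
      (Measure.pi fun _ => Measure.pi fun _ => complexGaussian)
      (Measure.pi fun _ => rayleighLaw M) :=
    measurePreserving_pi (fun _ : Fin M => Measure.pi fun _ : Fin M => complexGaussian)
      (fun _ : Fin M => rayleighLaw M) fun _ => measurePreserving_toLp_rayleighLaw
  have hy : Measurable fun ω i k => h i ω k :=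
    measurable_pi_lambda _ fun i => measurable_pi_lambda _ fun k => hm i k
  have h2 := Measure.map_map (μ := μ) hmp.measurable hy
  rw [h1, hmp.map_eq] at h2
  exact h2.symm

/-- The channels and codebooks of the mobiles are independent across the mobiles. -/
theorem measurePreserving_channels_codebooks (hh : IsRayleighFading μ h) (hW : IsRVQ μ W)
    (hhW : ChannelsIndepCodebooks μ h W) :
    MeasurePreserving (fun ω i => (h i ω, fun j => W i j ω)) μ
      (Measure.pi fun i => mobileLaw fun j => μ.map (W i j)) := by
  have hhm := hh.measurable
  have hWm := hW.measurable
  have hP : ∀ i j, IsProbabilityMeasure (μ.map (W i j)) :=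
    fun i j => (hW.codeword_law i j).isProbabilityMeasure
  have hWmap := map_eq_pi_pi_of_iIndepFun hWm hW.codeword_indep
  have h1 := IndepFun.map_prod_eq_prod_map_map (by fun_prop) (by fun_prop) hhW
  rw [hh.map_eq, hWmap] at h1
  -- Regroups a pair of families, channels and codebooks, into a family of pairs indexed by the
  -- mobiles.
  have hmp := (measurePreserving_arrowProdEquivProdArrow (CVec M) (Fin (2 ^ B) → CVec M) (Fin M)
    (fun _ => rayleighLaw M) (fun i => Measure.pi fun j => μ.map (W i j))).symm
  refine ⟨by fun_prop, ?_⟩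
  unfold mobileLaw
  rw [← hmp.map_eq, ← h1, Measure.map_map hmp.measurable (by fun_prop)]
  rfl

/-- Off the null set of ties the fed back codeword is the selected one, however `F` breaks ties and
whether or not it is measurable. -/
theorem ae_quantized_eq (hM : 2 ≤ M) (hh : IsRayleighFading μ h) (hW : IsRVQ μ W)
    (hhW : ChannelsIndepCodebooks μ h W) (hF : IsFeedback h W F) :
    ∀ᵐ ω ∂μ, ∀ i, quantized W F i ω =
      quantizedChannels (fun i => (h i ω, fun j => W i j ω)) i := by
  have hP := fun i => isProbabilityMeasure_mobileLaw fun j => hW.codeword_law i j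
  refine ae_all_iff.2 fun i => ?_
  have h1 := Measure.tendsto_eval_ae_ae (μ := fun i => mobileLaw fun j => μ.map (W i j)) (i := i)
    |>.eventually (ae_prod_selection_eq (fun j => hW.codeword_law i j) hM)
  have h2 := (measurePreserving_channels_codebooks hh hW hhW).quasiMeasurePreserving.ae h1
  filter_upwards [h2] with ω hω
  exact (hω (F i ω) (hF i ω)).symm

end Transfer

end FiniteRateFeedback

end

/-! ### The rate loss on the original probability space. -/

theorem theorem1 {Ω : Type*} [MeasurableSpace Ω] (μ : Measure Ω) [IsProbabilityMeasure μ]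
    (M B : ℕ) (hM : 2 ≤ M) (P : ℝ) (hP : 0 < P)
    (h : Fin M → Ω → FiniteRateFeedback.CVec M)
    (W : Fin M → Fin (2 ^ B) → Ω → FiniteRateFeedback.CVec M)
    (F : Fin M → Ω → Fin (2 ^ B))
    (hh : FiniteRateFeedback.IsRayleighFading μ h)
    (hW : FiniteRateFeedback.IsRVQ μ W)
    (hhW : FiniteRateFeedback.ChannelsIndepCodebooks μ h W)
    (hF : FiniteRateFeedback.IsFeedback h W F) :
    -- both channel matrices are almost surely invertible and both rates are integrable, so that
    -- the zero-forcing vectors and the throughputs are well defined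
    (∀ᵐ ω ∂μ, IsUnit (FiniteRateFeedback.concat fun i => h i ω).det) ∧
    (∀ᵐ ω ∂μ,
      IsUnit (FiniteRateFeedback.concat fun i => FiniteRateFeedback.quantized W F i ω).det) ∧
    (∀ i, Integrable (FiniteRateFeedback.instRateZF P h i) μ) ∧
    (∀ i, Integrable (FiniteRateFeedback.instRateFB P h W F i) μ) ∧
    -- the throughput loss of each mobile
    (∀ i, (∫ ω, FiniteRateFeedback.instRateZF P h i ω ∂μ) -
        (∫ ω, FiniteRateFeedback.instRateFB P h W F i ω ∂μ) <
      Real.logb 2 (1 + P * (2 : ℝ) ^ (-(B : ℝ) / ((M : ℝ) - 1)))) ∧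
    -- the rate gap
    FiniteRateFeedback.rateGap μ P h W F <
      Real.logb 2 (1 + P * (2 : ℝ) ^ (-(B : ℝ) / ((M : ℝ) - 1))) := by
  open FiniteRateFeedback in
  have hν := hW.codeword_law
  have hN : Nonempty (Fin (2 ^ B)) := ⟨⟨0, by positivity⟩⟩
  have hPr := fun i => isProbabilityMeasure_mobileLaw (hν i)
  have hmp := measurePreserving_channels_codebooks hh hW hhW
  have hq := ae_quantized_eq hM hh hW hhW hF
  have hFB : ∀ i, instRateFB P h W F i =ᵐ[μ]
      fun ω => canonicalRateFB P i (fun i => (h i ω, fun j => W i j ω)) := by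
    intro i
    filter_upwards [hq] with ω hω
    have : (fun j => quantized W F j ω) =
        quantizedChannels fun i => (h i ω, fun j => W i j ω) := funext hω
    rw [instRateFB, this, canonicalRateFB]
  have hiZF : ∀ i, Integrable (instRateZF P h i) μ := fun i =>
    hmp.integrable_comp_of_integrable (integrable_canonicalRateZF hν hP i)
  have hiFB : ∀ i, Integrable (instRateFB P h W F i) μ := fun i =>
    (hmp.integrable_comp_of_integrable (integrable_canonicalRateFB hν hP i)).congr (hFB i).symm
  have hgap : ∀ i, (∫ ω, instRateZF P h i ω ∂μ) - (∫ ω, instRateFB P h W F i ω ∂μ) <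
      Real.logb 2 (1 + P * (2 : ℝ) ^ (-(B : ℝ) / ((M : ℝ) - 1))) := by
    intro i
    have hlt := integral_canonicalRate_sub_lt hM hν hP i
    rw [← hmp.map_eq, integral_map hmp.measurable.aemeasurable (by
        rw [hmp.map_eq]; exact (integrable_canonicalRateZF hν hP i).1),
      integral_map hmp.measurable.aemeasurable (by
        rw [hmp.map_eq]; exact (integrable_canonicalRateFB hν hP i).1)] at hlt
    rw [integral_congr_ae (hFB i)]
    exact hlt
  refine ⟨?_, ?_, hiZF, hiFB, hgap, ?_⟩
  · filter_upwards [hmp.quasiMeasurePreserving.ae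
      (ae_linearIndependent_pi measurable_fst (nullOnHyperplanes_map_fst hν))] with ω hω
    exact (isUnit_det_concat_iff _).2 hω
  · filter_upwards [hq, hmp.quasiMeasurePreserving.ae
      (ae_linearIndependent_pi measurable_selection
        (nullOnHyperplanes_map_selection hM hν))] with ω hω1 hω2
    rw [isUnit_det_concat_iff, funext hω1]
    exact hω2
  · have hM0 : (0 : ℝ) < M := by
      have : (2 : ℝ) ≤ M := by exact_mod_cast hM
      linarith
    rw [rateGap, throughputZF, throughputFB, ← Finset.sum_sub_distrib, one_div,
      inv_mul_lt_iff₀ hM0]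
    -- The gap is the average of the individual losses; strictness survives because there is at
    -- least one mobile.
    refine (Finset.sum_lt_sum_of_nonempty ⟨⟨0, by omega⟩, Finset.mem_univ _⟩
      fun i _ => hgap i).trans_eq ?_
    simp
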